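/- Let $D\subset\mathbb R^d$ be a nonempty bounded open set, $D^c=\mathbb R^d\setminus D$. Let $\nu:\mathbb R^d\setminus\{0\}\to[0,\infty)$ be the density of a symmetric Lévy measure, i.e. $\nu$ is measurable, $\nu(-h)=\nu(h)$ and $\int_{\mathbb R^d}\min(1,|h|^2)\,\nu(h)\,dh<\infty$, and let $\nu$ have full support in the sense that $\nu>0$ almost everywhere. Let $\beta:D^c\to[0,\infty)$ be measurable, essentially bounded, and not almost everywhere zero. Put $$\mathcal Lu(x)=\mathrm{p.v.}\!\int_{\mathbb R^d}(u(x)-u(y))\,\nu(x-y)\,dy,\qquad \mathcal Nu(y)=\int_D(u(y)-u(x))\,\nu(x-y)\,dx ,$$ $$Q_\beta(u,v)=\frac12\iint_{(D^c\times D^c)^c}(u(x)-u(y))(v(x)-v(y))\,\nu(x-y)\,dx\,dy+\int_{D^c}\beta(y)u(y)v(y)\,dy .$$ Let $H$ be the space of measurable $u:\mathbb R^d\to\mathbb R$ with $\int_D u^2<\infty$, $\int_D\int_{\mathbb R^d}(u(x)-u(y))^2\nu(x-y)\,dy\,dx<\infty$ and $\int_{D^c}\beta u^2<\infty$, that is,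 $H=V_\nu(D\,|\,\mathbb R^d)\cap L^2(D^c;\beta)$. A number $\mu\in\mathbb R$ is an eigenvalue, with eigenfunction $\psi\in H$, $\psi|_D\neq0$ in $L^2(D)$, of the nonlocal Robin problem $$\mathcal L\psi=\mu\psi\ \text{ in }D,\qquad \mathcal N\psi+\beta\psi=0\ \text{ in }D^c,$$ if this holds in the weak sense, $Q_\beta(\psi,v)=\mu\int_D\psi v\,dx$ for all $v\in H$. Then the Robin problem has a smallest eigenvalue $\mu_1$, one has $\mu_1>0$, and $$\mu_1=\min\{\,Q_\beta(u,u)\;:\;u\in H,\ \|u\|_{L^2(D)}=1\,\},$$ where the minimum is attained. Moreover, there is an eigenfunction for $\mu_1$ that is strictly positive almost everywhere in $\mathbb R^d$. -/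

import Mathlib

open MeasureTheory

namespace NonlocalRobin

/-- The space `ℝ^d` with its Euclidean norm and Lebesgue measure. -/
abbrev Rd (d : ℕ) : Type := EuclideanSpace ℝ (Fin d)

/-- `ν` is the density of a symmetric Lévy measure on `ℝ^d ∖ {0}` and has full support, that is,
`ν > 0` almost everywhere. The value `ν 0` is irrelevant. -/
structure IsSymmetricLevyDensity {d : ℕ} (ν : Rd d → ℝ) : Prop where
  aemeasurable : AEMeasurable ν volume
  nonneg : ∀ h, 0 ≤ ν h
  symm : ∀ h, ν (-h) = ν h
  integrable : Integrable (fun h => min 1 (‖h‖ ^ 2) * ν h) volume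
  pos : ∀ᵐ h ∂(volume : Measure (Rd d)), 0 < ν h

/-- A Robin coefficient on `Dᶜ`: measurable, nonnegative, essentially bounded, and not almost
everywhere zero on `Dᶜ`. -/
structure IsRobinCoefficient {d : ℕ} (D : Set (Rd d)) (β : Rd d → ℝ) : Prop where
  aemeasurable : AEMeasurable β (volume.restrict Dᶜ)
  nonneg : ∀ᵐ y ∂(volume.restrict Dᶜ), 0 ≤ β y
  bounded : ∃ M : ℝ, ∀ᵐ y ∂(volume.restrict Dᶜ), β y ≤ M
  nontrivial : ¬ ∀ᵐ y ∂(volume.restrict Dᶜ), β y = 0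

/-- Membership in the space `V_ν(D | ℝ^d)`: `u : ℝ^d → ℝ` is (Lebesgue) measurable,
`u|_D ∈ L²(D)` and `∫_D ∫_{ℝ^d} (u(x) - u(y))² ν(x - y) dy dx < ∞`. -/
structure MemV {d : ℕ} (ν : Rd d → ℝ) (D : Set (Rd d)) (u : Rd d → ℝ) : Prop where
  aemeasurable : AEMeasurable u volume
  memLp : MemLp u 2 (volume.restrict D)
  seminorm_lt_top :
    ∫⁻ x in D, ∫⁻ y, ENNReal.ofReal ((u x - u y) ^ 2 * ν (x - y)) < ⊤

/-- Membership in `V_ν(D | ℝ^d) ∩ L²(Dᶜ; β)`, the space of admissible functions of the Robin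
problem. -/
structure MemForm {d : ℕ} (ν β : Rd d → ℝ) (D : Set (Rd d)) (u : Rd d → ℝ) : Prop
    extends MemV ν D u where
  weighted_lt_top : ∫⁻ y in Dᶜ, ENNReal.ofReal (β y * u y ^ 2) < ⊤

/-- The energy form
`ℰ(u,v) = 1/2 ∬_{(Dᶜ × Dᶜ)ᶜ} (u(x) - u(y)) (v(x) - v(y)) ν(x - y) dx dy`.
With the factor `1/2` the Gauss-Green formula `ℰ(u,v) = ∫_D (𝓛u) v + ∫_{Dᶜ} (𝒩u) v` holds for
`𝓛u(x) = p.v. ∫ (u(x) - u(y)) ν(x - y) dy` and `𝒩u(y) = ∫_D (u(y) - u(x)) ν(x - y) dx`. The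
integrand is integrable for `u`, `v` in `V_ν(D | ℝ^d)`. -/
noncomputable def energyForm {d : ℕ} (ν : Rd d → ℝ) (D : Set (Rd d)) (u v : Rd d → ℝ) : ℝ :=
  (1 / 2) * ∫ p in (Dᶜ ×ˢ Dᶜ : Set (Rd d × Rd d))ᶜ,
    (u p.1 - u p.2) * (v p.1 - v p.2) * ν (p.1 - p.2)

/-- The Robin form `Q_β(u,v) = ℰ(u,v) + ∫_{Dᶜ} β u v`. -/
noncomputable def robinForm {d : ℕ} (ν β : Rd d → ℝ) (D : Set (Rd d)) (u v : Rd d → ℝ) : ℝ :=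
  energyForm ν D u v + ∫ y in Dᶜ, β y * u y * v y

/-- `u` is a weak solution of `𝓛u = f` in `D`, `𝒩u + βu = 0` in `Dᶜ`:
`Q_β(u,v) = ∫_D f v` for all `v ∈ V_ν(D | ℝ^d) ∩ L²(Dᶜ; β)`. -/
def IsWeakRobinSolution {d : ℕ} (ν β : Rd d → ℝ) (D : Set (Rd d)) (f u : Rd d → ℝ) : Prop :=
  MemForm ν β D u ∧
    ∀ v : Rd d → ℝ, MemForm ν β D v → robinForm ν β D u v = ∫ x in D, f x * v x

/-- `(μ, ψ)` is an eigenpair of the Robin problem `𝓛ψ = μψ` in `D`, `𝒩ψ + βψ = 0` in `Dᶜ`: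
`ψ` is a weak solution with right-hand side `μψ`, and `ψ` is not the zero element of `L²(D)`. -/
def IsRobinEigenpair {d : ℕ} (ν β : Rd d → ℝ) (D : Set (Rd d)) (μ : ℝ) (ψ : Rd d → ℝ) : Prop :=
  IsWeakRobinSolution ν β D (fun x => μ * ψ x) ψ ∧ ¬ ∀ᵐ x ∂(volume.restrict D), ψ x = 0

/-- The set of eigenvalues of the Robin problem. -/
def robinEigenvalues {d : ℕ} (ν β : Rd d → ℝ) (D : Set (Rd d)) : Set ℝ :=
  {μ | ∃ ψ, IsRobinEigenpair ν β D μ ψ}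

end NonlocalRobin

/-! The proof is the direct method for the Rayleigh quotient, with infimum m. The embedding of the
form domain into L²(D) need not be compact (`ν` may even be integrable), so compactness is recovered
only for minimizing sequences, from the strict inequality m < ∫ν.

That inequality is `sInf_rayleighSet_lt`. If ∫ν = ∞ nothing is to be shown; otherwise a cone b
supported in a ball inside D has Q(b,b) = (∫ν)‖b‖² - ∬ b(x)b(y)ν(x-y), and the double integral is
strictly positive.

Hence some bounded, compactly supported symmetric kernel κ ≤ ν still has ∫κ > m. Write f = κ * (r
1_D) and N = κ * 1_D. Expanding the square in the κ-energy and minimizing over the values of r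
outside D gives `coercive_of_isTruncatedKernel`: (∫κ - η)‖r‖² ≤ Q(r,r) + C ∫ f²/N. For differences
of a weakly convergent sequence the last integral tends to zero. For differences d of a minimizing
sequence the parallelogram law gives Q(d,d) ≤ m‖d‖² + o(1). With η half the gap ∫κ - m, the two
bounds force ‖d‖ → 0 and then Q(d,d) → 0 (`exists_subseq_cauchy`).

To obtain a limit on all of ℝ^d, and not only in D, the sequence is placed in L² of a measure ρ
equivalent to Lebesgue measure whose norm is controlled by Q and ‖·‖_{L²(D)}
(`integral_formMeasure_le`). Completeness yields an almost everywhere limit of a subsequence, and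
Fatou's lemma makes it a minimizer (`exists_minimizer`).

The first variation gives the weak equation; testing any eigenfunction with itself shows that no
eigenvalue is below m. If Q(u,u) = 0 then u is constant almost everywhere, and since β is not null u
must vanish; so m > 0. Passing to |u| gives a nonnegative minimizer, and a strong minimum principle
(`ae_pos_of_eigenfunction`) makes it positive: the nonlocal energy couples the set where u is
positive in D directly with the zero set of u. -/

namespace NonlocalRobin

open Filter Topology

/-! ### Measurability and integrability on pairs of points; the form domain. -/

section

variable {d : ℕ} {ν β κ : Rd d → ℝ} {D : Set (Rd d)} {u v w : Rd d → ℝ}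

/-- The domain of integration of the energy form. -/
def crossSet (D : Set (Rd d)) : Set (Rd d × Rd d) := (Dᶜ ×ˢ Dᶜ)ᶜ

lemma quasiMeasurePreserving_diff :
    Measure.QuasiMeasurePreserving (fun p : Rd d × Rd d => p.1 - p.2) volume volume := by
  rw [Measure.volume_eq_prod]
  exact quasiMeasurePreserving_sub_of_right_invariant volume volume

lemma aemeasurable_kernel (hκ : AEMeasurable κ volume) :
    AEMeasurable (fun p : Rd d × Rd d => κ (p.1 - p.2)) volume :=
  hκ.comp_quasiMeasurePreserving quasiMeasurePreserving_diff

lemma ae_kernel_pos (h : ∀ᵐ h ∂(volume : Measure (Rd d)), 0 < κ h) :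
    ∀ᵐ p : Rd d × Rd d, 0 < κ (p.1 - p.2) :=
  quasiMeasurePreserving_diff.ae h

lemma aemeasurable_fst (hu : AEMeasurable u volume) :
    AEMeasurable (fun p : Rd d × Rd d => u p.1) volume := by
  rw [Measure.volume_eq_prod]
  exact hu.comp_quasiMeasurePreserving Measure.quasiMeasurePreserving_fst

lemma aemeasurable_snd (hu : AEMeasurable u volume) :
    AEMeasurable (fun p : Rd d × Rd d => u p.2) volume := by
  rw [Measure.volume_eq_prod]
  exact hu.comp_quasiMeasurePreserving Measure.quasiMeasurePreserving_snd

lemma aemeasurable_diff (hu : AEMeasurable u volume) :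
    AEMeasurable (fun p : Rd d × Rd d => u p.1 - u p.2) volume :=
  (aemeasurable_fst hu).sub (aemeasurable_snd hu)

/-- The energy density of a function, as a function on pairs of points. -/
def energyDensity (ν u : Rd d → ℝ) (p : Rd d × Rd d) : ℝ := (u p.1 - u p.2) ^ 2 * ν (p.1 - p.2)

lemma energyDensity_nonneg (hν : ∀ h, 0 ≤ ν h) (p : Rd d × Rd d) : 0 ≤ energyDensity ν u p :=
  mul_nonneg (sq_nonneg _) (hν _)

lemma aemeasurable_energyDensity (hν : AEMeasurable ν volume) (hu : AEMeasurable u volume) :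
    AEMeasurable (energyDensity ν u) volume :=
  ((aemeasurable_diff hu).pow_const 2).mul (aemeasurable_kernel hν)

lemma lintegral_left_eq (hν : AEMeasurable ν volume) (hu : AEMeasurable u volume) :
    ∫⁻ x in D, ∫⁻ y, ENNReal.ofReal ((u x - u y) ^ 2 * ν (x - y)) =
      ∫⁻ p in D ×ˢ Set.univ, ENNReal.ofReal (energyDensity ν u p) := by
  rw [Measure.volume_eq_prod, ← Measure.prod_restrict, Measure.restrict_univ,
    lintegral_prod]
  · rfl
  · have := (aemeasurable_energyDensity hν hu).ennreal_ofReal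
    rw [Measure.volume_eq_prod] at this
    refine this.mono_measure ?_
    rw [show (volume : Measure (Rd d)) = volume.restrict Set.univ by simp, Measure.prod_restrict]
    simpa using Measure.restrict_le_self

lemma lintegral_swap_eq (hsymm : ∀ h, ν (-h) = ν h) :
    ∫⁻ p in Set.univ ×ˢ D, ENNReal.ofReal (energyDensity ν u p) =
      ∫⁻ p in D ×ˢ Set.univ, ENNReal.ofReal (energyDensity ν u p) := by
  have hmp : MeasurePreserving (Prod.swap : Rd d × Rd d → Rd d × Rd d) volume volume := by
    rw [Measure.volume_eq_prod]; exact Measure.measurePreserving_swap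
  have := (hmp.setLIntegral_comp_preimage_emb
    (MeasurableEquiv.prodComm (α := Rd d) (β := Rd d)).measurableEmbedding
    (fun p => ENNReal.ofReal (energyDensity ν u p)) (Set.univ ×ˢ D))
  rw [← this]
  have h1 : (Prod.swap ⁻¹' (Set.univ ×ˢ D) : Set (Rd d × Rd d)) = D ×ˢ Set.univ := by
    ext p; simp
  rw [h1]
  congr 1
  ext p
  simp only [energyDensity, Prod.fst_swap, Prod.snd_swap]
  rw [← hsymm (p.2 - p.1), neg_sub, ← neg_sub (u p.1), neg_sq]

lemma crossSet_eq : crossSet D = D ×ˢ Set.univ ∪ Set.univ ×ˢ D := by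
  ext p; simp [crossSet]; tauto

/-- The domain of the energy form is the union of D × ℝ^d and its mirror image. Swapping coordinates
preserves the density by symmetry of `ν`, so finiteness on one half gives finiteness on both. -/
lemma lintegral_left_lt_top_iff (hν : IsSymmetricLevyDensity ν) (hu : AEMeasurable u volume) :
    ∫⁻ x in D, ∫⁻ y, ENNReal.ofReal ((u x - u y) ^ 2 * ν (x - y)) < ⊤ ↔
      IntegrableOn (energyDensity ν u) (crossSet D) := by
  have hm := aemeasurable_energyDensity hν.aemeasurable hu
  rw [lintegral_left_eq hν.aemeasurable hu, IntegrableOn,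
    ← lintegral_ofReal_ne_top_iff_integrable hm.restrict.aestronglyMeasurable
      (Filter.Eventually.of_forall (energyDensity_nonneg hν.nonneg)), ← lt_top_iff_ne_top]
  constructor
  · intro h
    rw [crossSet_eq]
    refine (lintegral_union_le _ _ _).trans_lt ?_
    rw [lintegral_swap_eq hν.symm]
    exact ENNReal.add_lt_top.2 ⟨h, h⟩
  · intro h
    refine (lintegral_mono_set ?_).trans_lt h
    rw [crossSet_eq]; exact Set.subset_union_left

lemma memForm_iff (hν : IsSymmetricLevyDensity ν) (hβ : IsRobinCoefficient D β) :
    MemForm ν β D u ↔ AEMeasurable u volume ∧ MemLp u 2 (volume.restrict D) ∧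
      IntegrableOn (energyDensity ν u) (crossSet D) ∧
      IntegrableOn (fun y => β y * u y ^ 2) Dᶜ := by
  have key : AEMeasurable u volume → (∫⁻ y in Dᶜ, ENNReal.ofReal (β y * u y ^ 2) < ⊤ ↔
      IntegrableOn (fun y => β y * u y ^ 2) Dᶜ) := by
    intro hu
    rw [IntegrableOn, ← lintegral_ofReal_ne_top_iff_integrable, lt_top_iff_ne_top]
    · exact (hβ.aemeasurable.mul (hu.restrict.pow_const 2)).aestronglyMeasurable
    · filter_upwards [hβ.nonneg] with y hy using mul_nonneg hy (sq_nonneg _)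
  constructor
  · intro h
    exact ⟨h.aemeasurable, h.memLp, (lintegral_left_lt_top_iff hν h.aemeasurable).1
      h.seminorm_lt_top, (key h.aemeasurable).1 h.weighted_lt_top⟩
  · rintro ⟨h1, h2, h3, h4⟩
    exact ⟨⟨h1, h2, (lintegral_left_lt_top_iff hν h1).2 h3⟩, (key h1).2 h4⟩

/-! ### Algebra and lattice operations in the form domain; bilinearity of the Robin form. -/

section Calculus

variable (hν : IsSymmetricLevyDensity ν) (hβ : IsRobinCoefficient D β)
include hν hβ

/-- Membership in the form domain is inherited by functions whose values and differences are
dominated by those of two members. -/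
lemma MemForm.of_dominated (hu : MemForm ν β D u) (hw : MemForm ν β D w) {C : ℝ}
    (hv : AEMeasurable v volume) (h1 : ∀ x, v x ^ 2 ≤ C * (u x ^ 2 + w x ^ 2))
    (h2 : ∀ x y, (v x - v y) ^ 2 ≤ C * ((u x - u y) ^ 2 + (w x - w y) ^ 2)) :
    MemForm ν β D v := by
  rw [memForm_iff hν hβ] at *
  obtain ⟨u1, u2, u3, u4⟩ := hu
  obtain ⟨w1, w2, w3, w4⟩ := hw
  refine ⟨hv, ?_, ?_, ?_⟩
  · rw [memLp_two_iff_integrable_sq hv.restrict.aestronglyMeasurable]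
    refine Integrable.mono' ((u2.integrable_sq.add w2.integrable_sq).const_mul C)
      (hv.restrict.pow_const 2).aestronglyMeasurable (Filter.Eventually.of_forall fun x => ?_)
    rw [Real.norm_of_nonneg (sq_nonneg _)]
    exact h1 x
  · refine Integrable.mono' ((u3.add w3).const_mul C)
      (aemeasurable_energyDensity hν.aemeasurable hv).restrict.aestronglyMeasurable
      (Filter.Eventually.of_forall fun p => ?_)
    rw [Real.norm_of_nonneg (energyDensity_nonneg hν.nonneg p)]
    have := mul_le_mul_of_nonneg_right (h2 p.1 p.2) (hν.nonneg (p.1 - p.2))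
    simp only [energyDensity, Pi.add_apply]
    linarith
  · refine Integrable.mono' ((u4.add w4).const_mul C)
      (hβ.aemeasurable.mul (hv.restrict.pow_const 2)).aestronglyMeasurable ?_
    filter_upwards [hβ.nonneg] with y hy
    rw [Real.norm_of_nonneg (mul_nonneg hy (sq_nonneg _))]
    have := mul_le_mul_of_nonneg_left (h1 y) hy
    simp only [Pi.add_apply]
    linarith

lemma MemForm.add (hu : MemForm ν β D u) (hw : MemForm ν β D w) :
    MemForm ν β D (fun x => u x + w x) := by
  refine MemForm.of_dominated hν hβ hu hw (C := 2) (hu.aemeasurable.add hw.aemeasurable) ?_ ?_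
  · intro x; nlinarith [sq_nonneg (u x - w x)]
  · intro x y; nlinarith [sq_nonneg ((u x - u y) - (w x - w y))]

lemma MemForm.const_mul (c : ℝ) (hu : MemForm ν β D u) :
    MemForm ν β D (fun x => c * u x) := by
  refine MemForm.of_dominated hν hβ hu hu (C := c ^ 2) (hu.aemeasurable.const_mul c) ?_ ?_
  · intro x; nlinarith [mul_nonneg (sq_nonneg c) (sq_nonneg (u x))]
  · intro x y; nlinarith [mul_nonneg (sq_nonneg c) (sq_nonneg (u x - u y))]

lemma MemForm.sub (hu : MemForm ν β D u) (hw : MemForm ν β D w) :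
    MemForm ν β D (fun x => u x - w x) := by
  simpa [sub_eq_add_neg] using hu.add hν hβ (hw.const_mul hν hβ (-1))

lemma MemForm.abs (hu : MemForm ν β D u) : MemForm ν β D (fun x => |u x|) := by
  refine MemForm.of_dominated hν hβ hu hu (C := 1) hu.aemeasurable.abs ?_ ?_
  · intro x; rw [sq_abs]; nlinarith [sq_nonneg (u x)]
  · intro x y
    have := sq_le_sq.2 (abs_abs_sub_abs_le_abs_sub (u x) (u y) |>.trans_eq rfl)
    nlinarith [sq_nonneg (u x - u y)]

lemma MemForm.posPart (hu : MemForm ν β D u) : MemForm ν β D (fun x => max (u x) 0) := by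
  refine MemForm.of_dominated hν hβ hu hu (C := 1) (hu.aemeasurable.max aemeasurable_const) ?_ ?_
  · intro x
    rcases max_cases (u x) 0 with h | h <;> rw [h.1] <;> nlinarith [sq_nonneg (u x)]
  · intro x y
    have := sq_le_sq.2 (abs_max_sub_max_le_abs (u x) (u y) 0)
    nlinarith [sq_nonneg (u x - u y)]

lemma MemForm.integrable_energy (hu : MemForm ν β D u) (hv : MemForm ν β D v) :
    IntegrableOn (fun p : Rd d × Rd d => (u p.1 - u p.2) * (v p.1 - v p.2) * ν (p.1 - p.2))
      (crossSet D) := by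
  have hu' := ((memForm_iff hν hβ).1 hu).2.2.1
  have hv' := ((memForm_iff hν hβ).1 hv).2.2.1
  refine Integrable.mono' (hu'.add hv')
    (((aemeasurable_diff hu.aemeasurable).mul (aemeasurable_diff hv.aemeasurable)).mul
      (aemeasurable_kernel hν.aemeasurable)).restrict.aestronglyMeasurable
    (Filter.Eventually.of_forall fun p => ?_)
  rw [norm_mul, Real.norm_of_nonneg (hν.nonneg _)]
  simp only [energyDensity, Pi.add_apply, ← add_mul]
  refine mul_le_mul_of_nonneg_right ?_ (hν.nonneg _)
  rw [Real.norm_eq_abs, abs_le]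
  constructor <;> nlinarith [sq_nonneg ((u p.1 - u p.2) - (v p.1 - v p.2)),
    sq_nonneg ((u p.1 - u p.2) + (v p.1 - v p.2)), sq_nonneg (u p.1 - u p.2),
    sq_nonneg (v p.1 - v p.2)]

lemma MemForm.integrable_boundary (hu : MemForm ν β D u) (hv : MemForm ν β D v) :
    IntegrableOn (fun y => β y * u y * v y) Dᶜ := by
  have hu' := ((memForm_iff hν hβ).1 hu).2.2.2
  have hv' := ((memForm_iff hν hβ).1 hv).2.2.2
  refine Integrable.mono' (hu'.add hv')
    ((hβ.aemeasurable.mul hu.aemeasurable.restrict).mul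
      hv.aemeasurable.restrict).aestronglyMeasurable ?_
  filter_upwards [hβ.nonneg] with y hy
  rw [mul_assoc, norm_mul, Real.norm_of_nonneg hy]
  simp only [Pi.add_apply, ← mul_add]
  refine mul_le_mul_of_nonneg_left ?_ hy
  rw [Real.norm_eq_abs, abs_le]
  constructor <;> nlinarith [sq_nonneg (u y - v y), sq_nonneg (u y + v y), sq_nonneg (u y),
    sq_nonneg (v y)]

lemma robinForm_add_left (hu : MemForm ν β D u) (hv : MemForm ν β D v) (hw : MemForm ν β D w) :
    robinForm ν β D (fun x => u x + v x) w = robinForm ν β D u w + robinForm ν β D v w := by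
  have e1 := integral_add (hu.integrable_energy hν hβ hw) (hv.integrable_energy hν hβ hw)
  have e2 := integral_add (hu.integrable_boundary hν hβ hw) (hv.integrable_boundary hν hβ hw)
  have e3 : (∫ p in crossSet D, (u p.1 + v p.1 - (u p.2 + v p.2)) * (w p.1 - w p.2) *
      ν (p.1 - p.2)) = ∫ p in crossSet D, ((u p.1 - u p.2) * (w p.1 - w p.2) * ν (p.1 - p.2) +
        (v p.1 - v p.2) * (w p.1 - w p.2) * ν (p.1 - p.2)) := by
    congr 1; ext p; ring
  have e4 : (∫ y in Dᶜ, β y * (u y + v y) * w y) =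
      ∫ y in Dᶜ, (β y * u y * w y + β y * v y * w y) := by
    congr 1; ext p; ring
  simp only [robinForm, energyForm, ← crossSet.eq_1] at *
  rw [e3, e4, e1, e2]; ring

omit hν hβ in
lemma robinForm_const_mul_left (c : ℝ) :
    robinForm ν β D (fun x => c * u x) v = c * robinForm ν β D u v := by
  have e1 : (∫ p in crossSet D, (c * u p.1 - c * u p.2) * (v p.1 - v p.2) * ν (p.1 - p.2)) =
      c * ∫ p in crossSet D, (u p.1 - u p.2) * (v p.1 - v p.2) * ν (p.1 - p.2) := by
    rw [← integral_const_mul]; congr 1; ext p; ring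
  have e2 : (∫ y in Dᶜ, β y * (c * u y) * v y) = c * ∫ y in Dᶜ, β y * u y * v y := by
    rw [← integral_const_mul]; congr 1; ext p; ring
  simp only [robinForm, energyForm, ← crossSet.eq_1] at *
  rw [e1, e2]; ring

omit hν hβ in
lemma robinForm_comm : robinForm ν β D u v = robinForm ν β D v u := by
  simp only [robinForm, energyForm]
  congr 2
  · congr 1; ext p; ring
  · ext p; ring

lemma robinForm_add_right (hu : MemForm ν β D u) (hv : MemForm ν β D v) (hw : MemForm ν β D w) :
    robinForm ν β D w (fun x => u x + v x) = robinForm ν β D w u + robinForm ν β D w v := by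
  rw [robinForm_comm, robinForm_add_left hν hβ hu hv hw, robinForm_comm (u := u),
    robinForm_comm (u := v)]

omit hν hβ in
lemma robinForm_const_mul_right (c : ℝ) :
    robinForm ν β D v (fun x => c * u x) = c * robinForm ν β D v u := by
  rw [robinForm_comm, robinForm_const_mul_left, robinForm_comm]

lemma robinForm_sub_left (hu : MemForm ν β D u) (hv : MemForm ν β D v) (hw : MemForm ν β D w) :
    robinForm ν β D (fun x => u x - v x) w = robinForm ν β D u w - robinForm ν β D v w := by
  have := robinForm_add_left hν hβ hu (hv.const_mul hν hβ (-1)) hw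
  rw [robinForm_const_mul_left] at this
  simpa [sub_eq_add_neg] using this

lemma robinForm_sub_right (hu : MemForm ν β D u) (hv : MemForm ν β D v) (hw : MemForm ν β D w) :
    robinForm ν β D w (fun x => u x - v x) = robinForm ν β D w u - robinForm ν β D w v := by
  rw [robinForm_comm, robinForm_sub_left hν hβ hu hv hw, robinForm_comm (u := u),
    robinForm_comm (u := v)]

omit hν hβ in
lemma robinForm_self_eq : robinForm ν β D u u =
    1 / 2 * (∫ p in crossSet D, energyDensity ν u p) + ∫ y in Dᶜ, β y * u y ^ 2 := by
  simp only [robinForm, energyForm, ← crossSet.eq_1, energyDensity]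
  congr 2
  · congr 1; ext p; ring
  · ext p; ring

omit hν in
lemma integral_boundary_nonneg : 0 ≤ ∫ y in Dᶜ, β y * u y ^ 2 :=
  integral_nonneg_of_ae (by filter_upwards [hβ.nonneg] with y hy using mul_nonneg hy (sq_nonneg _))

omit hβ in
lemma integral_energyDensity_nonneg : 0 ≤ ∫ p in crossSet D, energyDensity ν u p :=
  integral_nonneg (energyDensity_nonneg hν.nonneg)

lemma robinForm_self_nonneg : 0 ≤ robinForm ν β D u u := by
  rw [robinForm_self_eq]
  have := integral_boundary_nonneg hβ (u := u)
  have := integral_energyDensity_nonneg hν (u := u) (D := D)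
  positivity

end Calculus

end

/-! ### Lower semicontinuity of the Robin form by Fatou's lemma. -/

section

variable {d : ℕ} {ν β κ : Rd d → ℝ} {D : Set (Rd d)} {u v w : Rd d → ℝ}

lemma _root_.ENNReal.liminf_add_liminf_le (a b : ℕ → ENNReal) :
    liminf a atTop + liminf b atTop ≤ liminf (fun n => a n + b n) atTop := by
  simp only [liminf_eq_iSup_iInf_of_nat]
  rw [ENNReal.iSup_add_iSup_of_monotone]
  · refine iSup_mono fun n => le_iInf₂ fun i hi => ?_
    exact add_le_add (iInf₂_le i hi) (iInf₂_le i hi)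
  · intro m n hmn
    exact le_iInf₂ fun i hi => iInf₂_le i (hmn.trans hi)
  · intro m n hmn
    exact le_iInf₂ fun i hi => iInf₂_le i (hmn.trans hi)

/-- Puts the form into the extended nonnegative setting, where Fatou's lemma applies before the
limit is known to have finite energy. -/
lemma ofReal_robinForm_self (hν : IsSymmetricLevyDensity ν) (hβ : IsRobinCoefficient D β)
    (hu : MemForm ν β D u) :
    ENNReal.ofReal (robinForm ν β D u u) =
      (∫⁻ p in crossSet D, ENNReal.ofReal (1 / 2 * energyDensity ν u p)) +
        ∫⁻ y in Dᶜ, ENNReal.ofReal (β y * u y ^ 2) := by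
  obtain ⟨-, -, h3, h4⟩ := (memForm_iff hν hβ).1 hu
  rw [robinForm_self_eq, ENNReal.ofReal_add, ← integral_const_mul,
    ofReal_integral_eq_lintegral_ofReal (h3.const_mul _),
    ofReal_integral_eq_lintegral_ofReal h4]
  · filter_upwards [hβ.nonneg] with y hy using mul_nonneg hy (sq_nonneg _)
  · exact Eventually.of_forall fun p =>
      mul_nonneg (by norm_num) (energyDensity_nonneg hν.nonneg p)
  · exact mul_nonneg (by norm_num) (integral_energyDensity_nonneg hν)
  · exact integral_boundary_nonneg hβ

lemma memForm_of_lintegral_lt_top (hν : IsSymmetricLevyDensity ν) (hβ : IsRobinCoefficient D β)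
    (hu : AEMeasurable u volume) (h1 : ∫⁻ x in D, ENNReal.ofReal (u x ^ 2) < ⊤)
    (h2 : (∫⁻ p in crossSet D, ENNReal.ofReal (1 / 2 * energyDensity ν u p)) < ⊤)
    (h3 : ∫⁻ y in Dᶜ, ENNReal.ofReal (β y * u y ^ 2) < ⊤) : MemForm ν β D u := by
  rw [memForm_iff hν hβ]
  refine ⟨hu, ?_, ?_, ?_⟩
  · rw [memLp_two_iff_integrable_sq hu.restrict.aestronglyMeasurable,
      ← lintegral_ofReal_ne_top_iff_integrable
        (hu.restrict.pow_const 2).aestronglyMeasurable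
        (Eventually.of_forall fun _ => sq_nonneg _)]
    exact h1.ne
  · have hm := (aemeasurable_energyDensity hν.aemeasurable hu)
    have := (lintegral_ofReal_ne_top_iff_integrable
      (hm.const_mul (1 / 2)).restrict.aestronglyMeasurable
        (Eventually.of_forall fun p => mul_nonneg (by norm_num)
          (energyDensity_nonneg hν.nonneg p))).1 h2.ne
    refine (this.const_mul 2).congr (Eventually.of_forall fun p => ?_)
    simp only; ring
  · refine (lintegral_ofReal_ne_top_iff_integrable
      (hβ.aemeasurable.mul (hu.restrict.pow_const 2)).aestronglyMeasurable ?_).1 h3.ne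
    filter_upwards [hβ.nonneg] with y hy using mul_nonneg hy (sq_nonneg _)

/-- Lower semicontinuity of the Robin form under almost everywhere convergence. -/
lemma MemForm.of_tendsto_ae (hν : IsSymmetricLevyDensity ν) (hβ : IsRobinCoefficient D β)
    {us : ℕ → Rd d → ℝ} (hus : ∀ n, MemForm ν β D (us n))
    (hlim : ∀ᵐ x, Tendsto (fun n => us n x) atTop (𝓝 (u x)))
    {a : ℕ → ℝ} {A M : ℝ} (ha : Tendsto a atTop (𝓝 A))
    (hQ : ∀ n, robinForm ν β D (us n) (us n) ≤ a n) (hM : ∀ n, ∫ x in D, us n x ^ 2 ≤ M) :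
    MemForm ν β D u ∧ robinForm ν β D u u ≤ A := by
  have hum : AEMeasurable u volume :=
    aemeasurable_of_tendsto_metrizable_ae atTop (fun n => (hus n).aemeasurable) hlim
  have F1 : ∫⁻ x in D, ENNReal.ofReal (u x ^ 2) ≤ ENNReal.ofReal M := by
    have := lintegral_liminf_le' (μ := volume.restrict D) (u := atTop)
      (f := fun n x => ENNReal.ofReal (us n x ^ 2))
      (fun n => ((hus n).aemeasurable.restrict.pow_const 2).ennreal_ofReal)
    refine le_trans (le_of_eq (lintegral_congr_ae ?_)) (this.trans ?_)
    · filter_upwards [ae_restrict_of_ae hlim] with x hx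
      exact ((ENNReal.tendsto_ofReal (hx.pow 2)).liminf_eq).symm
    · refine (liminf_le_liminf (Eventually.of_forall fun n => ?_)).trans_eq
        (liminf_const (ENNReal.ofReal M))
      rw [← ofReal_integral_eq_lintegral_ofReal (hus n).memLp.integrable_sq
        (Eventually.of_forall fun _ => sq_nonneg _)]
      exact ENNReal.ofReal_le_ofReal (hM n)
  have F2 : (∫⁻ p in crossSet D, ENNReal.ofReal (1 / 2 * energyDensity ν u p)) ≤
      liminf (fun n => ∫⁻ p in crossSet D,
        ENNReal.ofReal (1 / 2 * energyDensity ν (us n) p)) atTop := by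
    refine le_trans (le_of_eq (lintegral_congr_ae ?_)) (lintegral_liminf_le' (u := atTop)
      (f := fun n p => ENNReal.ofReal (1 / 2 * energyDensity ν (us n) p))
      (fun n => ((aemeasurable_energyDensity hν.aemeasurable
        (hus n).aemeasurable).const_mul _).restrict.ennreal_ofReal))
    have e1 : ∀ᵐ p : Rd d × Rd d, Tendsto (fun n => us n p.1) atTop (𝓝 (u p.1)) := by
      rw [Measure.volume_eq_prod]; exact Measure.quasiMeasurePreserving_fst.ae hlim
    have e2 : ∀ᵐ p : Rd d × Rd d, Tendsto (fun n => us n p.2) atTop (𝓝 (u p.2)) := by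
      rw [Measure.volume_eq_prod]; exact Measure.quasiMeasurePreserving_snd.ae hlim
    filter_upwards [ae_restrict_of_ae e1, ae_restrict_of_ae e2] with p h1 h2
    exact ((ENNReal.tendsto_ofReal
      ((((h1.sub h2).pow 2).mul_const _).const_mul _)).liminf_eq).symm
  have F3 : (∫⁻ y in Dᶜ, ENNReal.ofReal (β y * u y ^ 2)) ≤
      liminf (fun n => ∫⁻ y in Dᶜ, ENNReal.ofReal (β y * us n y ^ 2)) atTop := by
    refine le_trans (le_of_eq (lintegral_congr_ae ?_)) (lintegral_liminf_le' (u := atTop)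
      (f := fun n y => ENNReal.ofReal (β y * us n y ^ 2))
      (fun n => (hβ.aemeasurable.mul
        ((hus n).aemeasurable.restrict.pow_const 2)).ennreal_ofReal))
    filter_upwards [ae_restrict_of_ae hlim] with p h1
    exact ((ENNReal.tendsto_ofReal ((h1.pow 2).const_mul _)).liminf_eq).symm
  -- Both Fatou bounds are added before comparing with A, because only the sum of interior and
  -- boundary terms is controlled by the bound on the form.
  have F : (∫⁻ p in crossSet D, ENNReal.ofReal (1 / 2 * energyDensity ν u p)) +
      (∫⁻ y in Dᶜ, ENNReal.ofReal (β y * u y ^ 2)) ≤ ENNReal.ofReal A := by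
    refine (add_le_add F2 F3).trans ((ENNReal.liminf_add_liminf_le _ _).trans ?_)
    rw [← (ENNReal.tendsto_ofReal ha).liminf_eq]
    refine liminf_le_liminf (Eventually.of_forall fun n => ?_)
    rw [← ofReal_robinForm_self hν hβ (hus n)]
    exact ENNReal.ofReal_le_ofReal (hQ n)
  have hmem : MemForm ν β D u := memForm_of_lintegral_lt_top hν hβ hum
    (F1.trans_lt ENNReal.ofReal_lt_top)
    ((le_self_add.trans F).trans_lt ENNReal.ofReal_lt_top)
    ((le_add_self.trans F).trans_lt ENNReal.ofReal_lt_top)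
  refine ⟨hmem, ?_⟩
  rw [← ofReal_robinForm_self hν hβ hmem] at F
  have hA : 0 ≤ A := ge_of_tendsto' ha fun n => (robinForm_self_nonneg hν hβ).trans (hQ n)
  exact (ENNReal.ofReal_le_ofReal_iff hA).1 F

/-! ### Cones as test functions, and a Rayleigh quotient below the mass of `ν`. -/

/-- A cone of height `r` over the ball of radius `r` about `z`. -/
noncomputable def cone (z : Rd d) (r : ℝ) (x : Rd d) : ℝ := max (r - ‖x - z‖) 0

lemma continuous_cone (z : Rd d) (r : ℝ) : Continuous (cone z r) := by
  unfold cone; fun_prop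

lemma cone_nonneg (z : Rd d) (r : ℝ) (x : Rd d) : 0 ≤ cone z r x := le_max_right _ _

lemma cone_pos {z : Rd d} {r : ℝ} {x : Rd d} (hx : x ∈ Metric.ball z r) : 0 < cone z r x := by
  rw [mem_ball_iff_norm] at hx
  exact lt_max_of_lt_left (by linarith)

lemma cone_eq_zero {z : Rd d} {r : ℝ} {x : Rd d} (hx : x ∉ Metric.ball z r) :
    cone z r x = 0 := by
  rw [mem_ball_iff_norm] at hx
  exact max_eq_right (by linarith)

lemma cone_le {z : Rd d} {r : ℝ} (hr : 0 ≤ r) (x : Rd d) : cone z r x ≤ r :=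
  max_le (by linarith [norm_nonneg (x - z)]) hr

lemma abs_cone_sub_le (z : Rd d) (r : ℝ) (x y : Rd d) :
    |cone z r x - cone z r y| ≤ ‖x - y‖ := by
  refine (abs_max_sub_max_le_abs _ _ _).trans ?_
  rw [sub_sub_sub_cancel_left, abs_sub_comm]
  refine (abs_norm_sub_norm_le _ _).trans_eq ?_
  congr 1; abel

lemma integrable_cone_sq (z : Rd d) (r : ℝ) : Integrable (fun x => cone z r x ^ 2) :=
  ((continuous_cone z r).pow 2).integrable_of_hasCompactSupport <| by
    refine HasCompactSupport.intro (isCompact_closedBall z r) fun x hx => ?_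
    simp [cone_eq_zero fun h => hx (Metric.ball_subset_closedBall h)]

/-- A cone is 1-Lipschitz with values in [0, r], so its squared increments are at most (1 + r²)
min(1, |x - y|²), which the Lévy condition makes integrable against `ν`, uniformly in x. Boundedness
of D and of `β` does the rest. -/
lemma memForm_cone (hν : IsSymmetricLevyDensity ν) (hβ : IsRobinCoefficient D β)
    (hD : Bornology.IsBounded D) (z : Rd d) {r : ℝ} (hr : 0 ≤ r) :
    MemForm ν β D (cone z r) := by
  have hm := (continuous_cone z r).measurable.aemeasurable (μ := volume)
  rw [memForm_iff hν hβ]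
  refine ⟨hm, ?_, ?_, ?_⟩
  · rw [memLp_two_iff_integrable_sq hm.restrict.aestronglyMeasurable]
    exact (integrable_cone_sq z r).restrict
  · rw [← lintegral_left_lt_top_iff hν hm]
    set G : Rd d → ENNReal := fun h => ENNReal.ofReal ((1 + r ^ 2) * (min 1 (‖h‖ ^ 2) * ν h))
    have hb : ∀ x y : Rd d, ENNReal.ofReal ((cone z r x - cone z r y) ^ 2 * ν (x - y)) ≤
        G (x - y) := by
      intro x y
      refine ENNReal.ofReal_le_ofReal ?_
      rw [← mul_assoc]
      refine mul_le_mul_of_nonneg_right ?_ (hν.nonneg _)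
      have h1 : (cone z r x - cone z r y) ^ 2 ≤ ‖x - y‖ ^ 2 :=
        sq_le_sq.2 ((abs_cone_sub_le z r x y).trans_eq (abs_norm _).symm)
      have h2 : (cone z r x - cone z r y) ^ 2 ≤ r ^ 2 :=
        sq_le_sq' (by linarith [cone_nonneg z r x, cone_le (z := z) hr y])
          (by linarith [cone_nonneg z r y, cone_le (z := z) hr x])
      rcases min_cases 1 (‖x - y‖ ^ 2) with h | h <;> rw [h.1]
      · linarith
      · nlinarith [mul_nonneg (sq_nonneg r) (sq_nonneg ‖x - y‖)]
    have hG : ∫⁻ h, G h < ⊤ := (hν.integrable.const_mul _).lintegral_lt_top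
    calc ∫⁻ x in D, ∫⁻ y, ENNReal.ofReal ((cone z r x - cone z r y) ^ 2 * ν (x - y))
        ≤ ∫⁻ x in D, ∫⁻ y, G (x - y) := lintegral_mono fun x => lintegral_mono fun y => hb x y
      _ = ∫⁻ x in D, ∫⁻ h, G h := by
        congr 1; ext x; exact lintegral_sub_left_eq_self G x
      _ = (∫⁻ h, G h) * volume D := by rw [lintegral_const]; simp
      _ < ⊤ := ENNReal.mul_lt_top hG hD.measure_lt_top
  · obtain ⟨M, hM⟩ := hβ.bounded
    refine Integrable.mono' ((integrable_cone_sq z r).restrict.const_mul M)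
      (hβ.aemeasurable.mul (hm.restrict.pow_const 2)).aestronglyMeasurable ?_
    filter_upwards [hβ.nonneg, hM] with y h1 h2
    rw [Real.norm_of_nonneg (mul_nonneg h1 (sq_nonneg _))]
    exact mul_le_mul_of_nonneg_right h2 (sq_nonneg _)

lemma integrable_prod_conv {f : Rd d → ℝ} {ρ : Measure (Rd d)} [SFinite ρ]
    (hf : Integrable f ρ) (hκ : Integrable κ volume) :
    Integrable (fun p : Rd d × Rd d => f p.2 * κ (p.1 - p.2)) (volume.prod ρ) :=
  hf.convolution_integrand (ContinuousLinearMap.mul ℝ ℝ) hκ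

lemma integral_prod_conv {f : Rd d → ℝ} {ρ : Measure (Rd d)} [SFinite ρ]
    (hf : Integrable f ρ) (hκ : Integrable κ volume) :
    ∫ p, f p.2 * κ (p.1 - p.2) ∂(volume.prod ρ) = (∫ h, κ h) * ∫ x, f x ∂ρ := by
  rw [integral_prod_symm _ (integrable_prod_conv hf hκ), ← integral_const_mul]
  congr 1; ext x
  simp only
  rw [integral_const_mul, integral_sub_right_eq_self κ x, mul_comm]

/-- The cone b vanishes off D, so the boundary term is zero and the energy is that over the whole
space. Expanding the square leaves (∫ν)‖b‖² minus ∬ b(x)b(y)ν(x-y), which is strictly positive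
because `ν` is positive almost everywhere. -/
lemma robinForm_cone_lt (hν : IsSymmetricLevyDensity ν)
    {z : Rd d} {r : ℝ} (hr : 0 < r) (hD : Metric.ball z r ⊆ D) (hint : Integrable ν) :
    robinForm ν β D (cone z r) (cone z r) < (∫ h, ν h) * ∫ x in D, cone z r x ^ 2 := by
  set b := cone z r with hbdef
  have hb0 : ∀ x ∉ D, b x = 0 := fun x hx => cone_eq_zero fun h => hx (hD h)
  have hbm : AEMeasurable b volume := (continuous_cone z r).measurable.aemeasurable
  have I1 : Integrable (fun p : Rd d × Rd d => b p.2 ^ 2 * ν (p.1 - p.2)) := by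
    rw [Measure.volume_eq_prod]; exact integrable_prod_conv (integrable_cone_sq z r) hint
  have E1 : ∫ p : Rd d × Rd d, b p.2 ^ 2 * ν (p.1 - p.2) = (∫ h, ν h) * ∫ x, b x ^ 2 := by
    rw [Measure.volume_eq_prod]; exact integral_prod_conv (integrable_cone_sq z r) hint
  have hmp : MeasurePreserving (Prod.swap : Rd d × Rd d → Rd d × Rd d) volume volume := by
    rw [Measure.volume_eq_prod]; exact Measure.measurePreserving_swap
  have hemb : MeasurableEmbedding (Prod.swap : Rd d × Rd d → Rd d × Rd d) :=
    (MeasurableEquiv.prodComm (α := Rd d) (β := Rd d)).measurableEmbedding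
  have hsw : (fun p : Rd d × Rd d => b p.1 ^ 2 * ν (p.1 - p.2)) =
      (fun p : Rd d × Rd d => b p.2 ^ 2 * ν (p.1 - p.2)) ∘ Prod.swap := by
    ext p; simp only [Function.comp, Prod.fst_swap, Prod.snd_swap]
    rw [← hν.symm (p.2 - p.1), neg_sub]
  have I2 : Integrable (fun p : Rd d × Rd d => b p.1 ^ 2 * ν (p.1 - p.2)) := by
    rw [hsw]; exact (hmp.integrable_comp_emb hemb).2 I1
  have E2 : ∫ p : Rd d × Rd d, b p.1 ^ 2 * ν (p.1 - p.2) = (∫ h, ν h) * ∫ x, b x ^ 2 := by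
    rw [hsw, ← E1]; exact hmp.integral_comp hemb (fun p : Rd d × Rd d => b p.2 ^ 2 * ν (p.1 - p.2))
  have hc0 : ∀ p : Rd d × Rd d, 0 ≤ b p.1 * b p.2 * ν (p.1 - p.2) := fun p =>
    mul_nonneg (mul_nonneg (cone_nonneg z r _) (cone_nonneg z r _)) (hν.nonneg _)
  have I3 : Integrable (fun p : Rd d × Rd d => b p.1 * b p.2 * ν (p.1 - p.2)) := by
    refine Integrable.mono' (I1.add I2) (((aemeasurable_fst hbm).mul (aemeasurable_snd hbm)).mul
      (aemeasurable_kernel hν.aemeasurable)).aestronglyMeasurable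
      (Eventually.of_forall fun p => ?_)
    rw [Real.norm_of_nonneg (hc0 p)]
    simp only [Pi.add_apply, ← add_mul]
    refine mul_le_mul_of_nonneg_right ?_ (hν.nonneg _)
    nlinarith [sq_nonneg (b p.1 - b p.2), sq_nonneg (b p.1), sq_nonneg (b p.2)]
  have hpos : 0 < ∫ p : Rd d × Rd d, b p.1 * b p.2 * ν (p.1 - p.2) := by
    rw [integral_pos_iff_support_of_nonneg hc0 I3]
    have hball : 0 < volume (Metric.ball z r ×ˢ Metric.ball z r) := by
      rw [Measure.volume_eq_prod, Measure.prod_prod]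
      exact ENNReal.mul_pos (Metric.measure_ball_pos _ _ hr).ne'
        (Metric.measure_ball_pos _ _ hr).ne'
    refine hball.trans_le (measure_mono_ae ?_)
    filter_upwards [ae_kernel_pos hν.pos] with p hp hmem
    exact (mul_pos (mul_pos (cone_pos hmem.1) (cone_pos hmem.2)) hp).ne'
  have hD2 : ∫ x in D, b x ^ 2 = ∫ x, b x ^ 2 :=
    setIntegral_eq_integral_of_forall_compl_eq_zero fun x hx => by simp [hb0 x hx]
  have hS : ∫ p in crossSet D, energyDensity ν b p = ∫ p, energyDensity ν b p := by
    refine setIntegral_eq_integral_of_forall_compl_eq_zero fun p hp => ?_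
    simp only [crossSet, Set.mem_compl_iff, not_not, Set.mem_prod] at hp
    simp [energyDensity, hb0 _ hp.1, hb0 _ hp.2]
  have hexp : ∫ p, energyDensity ν b p = (∫ p : Rd d × Rd d, b p.1 ^ 2 * ν (p.1 - p.2)) +
      (∫ p : Rd d × Rd d, b p.2 ^ 2 * ν (p.1 - p.2)) -
      2 * ∫ p : Rd d × Rd d, b p.1 * b p.2 * ν (p.1 - p.2) := by
    rw [← integral_const_mul, ← integral_add I2 I1, ← integral_sub _ (I3.const_mul 2)]
    rotate_left
    · exact I2.add I1
    congr 1; ext p; simp only [energyDensity]; ring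
  have hB : ∫ y in Dᶜ, β y * b y ^ 2 = 0 :=
    setIntegral_eq_zero_of_forall_eq_zero fun y hy => by simp [hb0 y hy]
  rw [robinForm_self_eq, hB, hS, hexp, E1, E2, hD2]
  linarith

end

/-! ### Truncated kernels and the coercivity estimate. -/

section

variable {d : ℕ} {ν β κ : Rd d → ℝ} {D : Set (Rd d)} {r : Rd d → ℝ} {K : ℝ}

/-- `κ` is a symmetric kernel dominated by `ν`, bounded by `K` and supported in the closed ball
of radius `K`. -/
structure IsTruncatedKernel (ν κ : Rd d → ℝ) (K : ℝ) : Prop where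
  aemeasurable : AEMeasurable κ volume
  nonneg : ∀ h, 0 ≤ κ h
  symm : ∀ h, κ (-h) = κ h
  le : ∀ h, κ h ≤ ν h
  bounded : ∀ h, κ h ≤ K
  support : ∀ h, K < ‖h‖ → κ h = 0

lemma IsTruncatedKernel.integrable (hκ : IsTruncatedKernel ν κ K) : Integrable κ := by
  have h1 : IntegrableOn κ (Metric.closedBall 0 K) :=
    Measure.integrableOn_of_bounded (M := K) measure_closedBall_lt_top.ne
      hκ.aemeasurable.aestronglyMeasurable
      (Eventually.of_forall fun h => by
        rw [Real.norm_of_nonneg (hκ.nonneg h)]; exact hκ.bounded h)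
  rwa [integrableOn_iff_integrable_of_support_subset] at h1
  intro h hh
  rw [mem_closedBall_zero_iff]
  by_contra hlt
  exact hh (hκ.support h (not_le.1 hlt))

/-- The convolution of a kernel with the restriction of a function to `D`. -/
noncomputable def convOn (κ : Rd d → ℝ) (D : Set (Rd d)) (f : Rd d → ℝ) (y : Rd d) : ℝ :=
  ∫ x in D, f x * κ (y - x)

lemma aestronglyMeasurable_shift (hκ : AEMeasurable κ volume) (y : Rd d) :
    AEStronglyMeasurable (fun x => κ (y - x)) volume :=
  (hκ.comp_quasiMeasurePreserving
    (quasiMeasurePreserving_sub_left_of_right_invariant volume y)).aestronglyMeasurable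

lemma IsTruncatedKernel.integrable_mul (hκ : IsTruncatedKernel ν κ K) {f : Rd d → ℝ}
    (hf : IntegrableOn f D) (y : Rd d) : IntegrableOn (fun x => f x * κ (y - x)) D := by
  refine hf.mul_bdd (c := K) (aestronglyMeasurable_shift hκ.aemeasurable y).restrict
    (Eventually.of_forall fun h => ?_)
  rw [Real.norm_of_nonneg (hκ.nonneg _)]; exact hκ.bounded _

lemma IsTruncatedKernel.integrable_prod (hκ : IsTruncatedKernel ν κ K) {f : Rd d → ℝ}
    (hf : IntegrableOn f D) : Integrable (fun p : Rd d × Rd d => f p.2 * κ (p.1 - p.2))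
      (volume.prod (volume.restrict D)) :=
  integrable_prod_conv hf hκ.integrable

lemma IsTruncatedKernel.integrable_convOn (hκ : IsTruncatedKernel ν κ K) {f : Rd d → ℝ}
    (hf : IntegrableOn f D) : Integrable (convOn κ D f) :=
  (hκ.integrable_prod hf).integral_prod_left

lemma IsTruncatedKernel.integral_convOn (hκ : IsTruncatedKernel ν κ K) {f : Rd d → ℝ}
    (hf : IntegrableOn f D) : ∫ y, convOn κ D f y = (∫ h, κ h) * ∫ x in D, f x := by
  rw [← integral_prod_conv hf hκ.integrable, integral_prod _ (hκ.integrable_prod hf)]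
  rfl

lemma IsTruncatedKernel.convOn_nonneg (hκ : IsTruncatedKernel ν κ K) {f : Rd d → ℝ}
    (hf : ∀ x, 0 ≤ f x) (y : Rd d) : 0 ≤ convOn κ D f y :=
  integral_nonneg fun x => mul_nonneg (hf x) (hκ.nonneg _)

lemma IsTruncatedKernel.convOn_le (hκ : IsTruncatedKernel ν κ K) {f : Rd d → ℝ}
    (hf : IntegrableOn f D) (h0 : ∀ x, 0 ≤ f x) (y : Rd d) :
    convOn κ D f y ≤ K * ∫ x in D, f x := by
  rw [← integral_const_mul]
  refine integral_mono (hκ.integrable_mul hf y) (hf.const_mul K) fun x => ?_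
  simp only
  rw [mul_comm]
  exact mul_le_mul_of_nonneg_right (hκ.bounded _) (h0 x)

lemma IsTruncatedKernel.convOn_eq_zero (hκ : IsTruncatedKernel ν κ K) {f : Rd d → ℝ} {R : ℝ}
    (hR : D ⊆ Metric.closedBall 0 R) {y : Rd d} (hy : R + K < ‖y‖) :
    convOn κ D f y = 0 := by
  refine setIntegral_eq_zero_of_forall_eq_zero fun x hx => ?_
  have := mem_closedBall_zero_iff.1 (hR hx)
  rw [hκ.support _ (by linarith [norm_sub_norm_le y x]), mul_zero]

section

variable (hκ : IsTruncatedKernel ν κ K) (hr : MemLp r 2 (volume.restrict D))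
  (hfin : volume D ≠ ⊤)
include hκ hr hfin

lemma integral_sq_sub_mul (y : Rd d) (t : ℝ) :
    ∫ x in D, (t - r x) ^ 2 * κ (y - x) =
      convOn κ D (fun x => r x ^ 2) y - 2 * t * convOn κ D r y +
        t ^ 2 * convOn κ D (fun _ => 1) y := by
  have : IsFiniteMeasure (volume.restrict D) := ⟨by simpa using hfin.lt_top⟩
  have I0 := hκ.integrable_mul (D := D) (f := fun _ => 1) (integrable_const 1) y
  have I1 := hκ.integrable_mul (hr.integrable one_le_two) y
  have I2 := hκ.integrable_mul hr.integrable_sq y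
  simp only [convOn]
  rw [← integral_const_mul, ← integral_const_mul, ← integral_sub I2 (I1.const_mul _),
    ← integral_add _ (I0.const_mul _)]
  · congr 1; ext x; ring
  · exact I2.sub (I1.const_mul _)

/-- Cauchy–Schwarz for the weight κ(y - ·) on D, read off from the discriminant of the nonnegative
quadratic t ↦ ∫_D (t - r(x))² κ(y - x) dx. -/
lemma convOn_sq_le (y : Rd d) :
    convOn κ D r y ^ 2 ≤ convOn κ D (fun _ => 1) y * convOn κ D (fun x => r x ^ 2) y := by
  have := discrim_le_zero (a := convOn κ D (fun _ => 1) y) (b := - 2 * convOn κ D r y)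
    (c := convOn κ D (fun x => r x ^ 2) y) fun t => by
      have h1 := integral_sq_sub_mul hκ hr hfin y t
      have h2 : 0 ≤ ∫ x in D, (t - r x) ^ 2 * κ (y - x) :=
        integral_nonneg fun x => mul_nonneg (sq_nonneg _) (hκ.nonneg _)
      nlinarith
  unfold discrim at this
  nlinarith

/-- The quotient f²/N is the error left after minimizing over exterior values. Where N = 0 it is 0
by the convention for division, which is harmless since f vanishes there too. The bound makes it
integrable over ℝ^d. -/
lemma convOn_sq_div_le (y : Rd d) :
    convOn κ D r y ^ 2 / convOn κ D (fun _ => 1) y ≤ convOn κ D (fun x => r x ^ 2) y := by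
  have hN := hκ.convOn_nonneg (D := D) (f := fun _ => 1) (fun _ => zero_le_one) y
  have hg := hκ.convOn_nonneg (D := D) (f := fun x => r x ^ 2) (fun _ => sq_nonneg _) y
  refine div_le_of_le_mul₀ hN hg ?_
  rw [mul_comm]; exact convOn_sq_le hκ hr hfin y

lemma convOn_sq_eq (y : Rd d) :
    convOn κ D r y ^ 2 = convOn κ D (fun _ => 1) y *
      (convOn κ D r y ^ 2 / convOn κ D (fun _ => 1) y) := by
  by_cases h : convOn κ D (fun _ => 1) y = 0
  · have := convOn_sq_le hκ hr hfin y
    rw [h, zero_mul] at this ⊢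
    exact le_antisymm this (sq_nonneg _)
  · field_simp

lemma integrable_convOn_sq_div :
    Integrable (fun y => convOn κ D r y ^ 2 / convOn κ D (fun _ => 1) y) := by
  have : IsFiniteMeasure (volume.restrict D) := ⟨by simpa using hfin.lt_top⟩
  have h1 := (hκ.integrable_convOn (D := D) (hr.integrable one_le_two)).aestronglyMeasurable
  have h2 := (hκ.integrable_convOn (D := D) (f := fun _ => 1)
    (integrable_const 1)).aestronglyMeasurable
  refine Integrable.mono' (hκ.integrable_convOn hr.integrable_sq)
    (h1.aemeasurable.pow_const 2 |>.div h2.aemeasurable).aestronglyMeasurable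
    (Eventually.of_forall fun y => ?_)
  rw [Real.norm_of_nonneg (div_nonneg (sq_nonneg _)
    (hκ.convOn_nonneg (fun _ => zero_le_one) y))]
  exact convOn_sq_div_le hκ hr hfin y

lemma integrable_sq_mul_convOn_one :
    IntegrableOn (fun y => r y ^ 2 * convOn κ D (fun _ => 1) y) D := by
  have : IsFiniteMeasure (volume.restrict D) := ⟨by simpa using hfin.lt_top⟩
  have h2 := (hκ.integrable_convOn (D := D) (f := fun _ => 1)
    (integrable_const 1)).aestronglyMeasurable
  refine hr.integrable_sq.mul_bdd (c := K * ∫ _ in D, (1 : ℝ)) h2.restrict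
    (Eventually.of_forall fun y => ?_)
  rw [Real.norm_of_nonneg (hκ.convOn_nonneg (fun _ => zero_le_one) y)]
  exact hκ.convOn_le (integrable_const 1) (fun _ => zero_le_one) y

lemma integrable_sq_convOn : IntegrableOn (fun y => convOn κ D r y ^ 2) D := by
  have : IsFiniteMeasure (volume.restrict D) := ⟨by simpa using hfin.lt_top⟩
  have h1 := (hκ.integrable_convOn (D := D) (hr.integrable one_le_two)).aestronglyMeasurable
  refine Integrable.mono' ((integrable_convOn_sq_div hκ hr hfin).const_mul
    (K * ∫ _ in D, (1 : ℝ))).integrableOn (h1.aemeasurable.pow_const 2).aestronglyMeasurable.restrict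
    (Eventually.of_forall fun y => ?_)
  rw [Real.norm_of_nonneg (sq_nonneg _)]
  conv_lhs => rw [convOn_sq_eq hκ hr hfin y]
  exact mul_le_mul_of_nonneg_right (hκ.convOn_le (D := D) (f := fun _ => 1) (integrable_const 1)
    (fun _ => zero_le_one) y) (div_nonneg (sq_nonneg _) (hκ.convOn_nonneg (fun _ => zero_le_one) y))

/-- Pointwise f² = N · (f²/N) and N ≤ K|D|, so the interior error is controlled by the same quantity
as the exterior one. -/
lemma integral_sq_convOn_le :
    ∫ y in D, convOn κ D r y ^ 2 ≤ (K * ∫ _ in D, (1 : ℝ)) *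
      ∫ y, convOn κ D r y ^ 2 / convOn κ D (fun _ => 1) y := by
  have : IsFiniteMeasure (volume.restrict D) := ⟨by simpa using hfin.lt_top⟩
  have hh := integrable_convOn_sq_div hκ hr hfin
  have h0 : ∀ y, 0 ≤ convOn κ D r y ^ 2 / convOn κ D (fun _ => 1) y := fun y =>
    div_nonneg (sq_nonneg _) (hκ.convOn_nonneg (fun _ => zero_le_one) y)
  have hC : 0 ≤ K * ∫ _ in D, (1 : ℝ) :=
    (hκ.convOn_nonneg (D := D) (f := fun _ => 1) (fun _ => zero_le_one) 0).trans
      (hκ.convOn_le (integrable_const 1) (fun _ => zero_le_one) 0)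
  calc ∫ y in D, convOn κ D r y ^ 2
      ≤ ∫ y in D, (K * ∫ _ in D, (1 : ℝ)) *
          (convOn κ D r y ^ 2 / convOn κ D (fun _ => 1) y) := by
        refine integral_mono (integrable_sq_convOn hκ hr hfin) (hh.const_mul _).integrableOn
          fun y => ?_
        simp only
        conv_lhs => rw [convOn_sq_eq hκ hr hfin y]
        exact mul_le_mul_of_nonneg_right
          (hκ.convOn_le (integrable_const 1) (fun _ => zero_le_one) y) (h0 y)
    _ = (K * ∫ _ in D, (1 : ℝ)) *
          ∫ y in D, convOn κ D r y ^ 2 / convOn κ D (fun _ => 1) y := integral_const_mul _ _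
    _ ≤ _ := mul_le_mul_of_nonneg_left
        (setIntegral_le_integral hh (Eventually.of_forall h0)) hC

lemma integrable_mul_convOn : IntegrableOn (fun y => r y * convOn κ D r y) D := by
  have : IsFiniteMeasure (volume.restrict D) := ⟨by simpa using hfin.lt_top⟩
  have h1 := (hκ.integrable_convOn (D := D) (hr.integrable one_le_two)).aestronglyMeasurable
  refine Integrable.mono' (hr.integrable_sq.add (integrable_sq_convOn hκ hr hfin))
    (hr.aestronglyMeasurable.mul h1.restrict) (Eventually.of_forall fun y => ?_)
  rw [Real.norm_eq_abs, abs_le]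
  simp only [Pi.add_apply]
  constructor <;> nlinarith [sq_nonneg (r y - convOn κ D r y), sq_nonneg (r y + convOn κ D r y)]

omit hfin in
-- Fubini on D × D together with the symmetry of κ.
lemma integral_sq_mul_convOn_one :
    ∫ y in D, r y ^ 2 * convOn κ D (fun _ => 1) y = ∫ y in D, convOn κ D (fun x => r x ^ 2) y := by
  have hI : Integrable (fun p : Rd d × Rd d => r p.2 ^ 2 * κ (p.1 - p.2))
      ((volume.restrict D).prod (volume.restrict D)) :=
    (hκ.integrable_prod hr.integrable_sq).mono_measure
      (Measure.prod_mono Measure.restrict_le_self le_rfl)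
  have := integral_integral_swap (f := fun y x => r x ^ 2 * κ (y - x)) hI
  simp only [convOn]
  rw [this]
  congr 1; ext x
  rw [← integral_const_mul]
  congr 1; ext y
  rw [one_mul, ← hκ.symm, neg_sub]

/-- A lower bound for the energy in terms of a truncated kernel: the truncated energy is coercive
on `L²(D)` up to terms that are continuous for the weak topology. -/
lemma integral_kernel_mul_le (hDm : MeasurableSet D)
    (hrm : AEMeasurable r volume)
    (hE : IntegrableOn (energyDensity ν r) (crossSet D)) :
    (∫ h, κ h) * ∫ x in D, r x ^ 2 ≤ 1 / 2 * (∫ p in crossSet D, energyDensity ν r p) +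
      (∫ y in D, r y * convOn κ D r y) +
        ∫ y in Dᶜ, convOn κ D r y ^ 2 / convOn κ D (fun _ => 1) y := by
  have hle : ∀ p, energyDensity κ r p ≤ energyDensity ν r p := fun p =>
    mul_le_mul_of_nonneg_left (hκ.le _) (sq_nonneg _)
  have h0 : ∀ p, 0 ≤ energyDensity κ r p := fun p => energyDensity_nonneg hκ.nonneg p
  have hEκ : IntegrableOn (energyDensity κ r) (crossSet D) :=
    Integrable.mono' hE (aemeasurable_energyDensity hκ.aemeasurable hrm).restrict.aestronglyMeasurable
      (Eventually.of_forall fun p => by rw [Real.norm_of_nonneg (h0 p)]; exact hle p)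
  have hmono : ∫ p in crossSet D, energyDensity κ r p ≤ ∫ p in crossSet D, energyDensity ν r p :=
    integral_mono hEκ hE hle
  set e : Rd d → ℝ := fun y => ∫ x in D, (r y - r x) ^ 2 * κ (y - x) with he
  set f := convOn κ D r with hf
  set N := convOn κ D (fun _ => 1) with hN
  set g := convOn κ D (fun x => r x ^ 2) with hg
  have hee : ∀ y, e y = g y - 2 * r y * f y + r y ^ 2 * N y := fun y =>
    integral_sq_sub_mul hκ hr hfin y (r y)
  have hU : IntegrableOn (energyDensity κ r) (Set.univ ×ˢ D) :=
    hEκ.mono_set (by rw [crossSet_eq]; exact Set.subset_union_right)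
  have hprod : ∀ s : Set (Rd d), (volume : Measure (Rd d × Rd d)).restrict (s ×ˢ D) =
      (volume.restrict s).prod (volume.restrict D) := fun s => by
    rw [Measure.volume_eq_prod, Measure.prod_restrict]
  have hU' : Integrable (energyDensity κ r) (volume.prod (volume.restrict D)) := by
    have := hU
    rwa [IntegrableOn, hprod, Measure.restrict_univ] at this
  have Ie : Integrable e := hU'.integral_prod_left
  have hset : ∀ s : Set (Rd d), ∫ p in s ×ˢ D, energyDensity κ r p = ∫ y in s, e y := fun s => by
    rw [hprod, integral_prod _ (hU'.mono_measure
      (Measure.prod_mono Measure.restrict_le_self le_rfl))]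
    rfl
  have hswap : ∫ p in D ×ˢ Dᶜ, energyDensity κ r p = ∫ p in Dᶜ ×ˢ D, energyDensity κ r p := by
    have hmp : MeasurePreserving (Prod.swap : Rd d × Rd d → Rd d × Rd d) volume volume := by
      rw [Measure.volume_eq_prod]; exact Measure.measurePreserving_swap
    have hemb : MeasurableEmbedding (Prod.swap : Rd d × Rd d → Rd d × Rd d) :=
      (MeasurableEquiv.prodComm (α := Rd d) (β := Rd d)).measurableEmbedding
    rw [← hmp.setIntegral_preimage_emb hemb, Set.preimage_swap_prod]
    congr 1; ext p
    simp only [energyDensity, Prod.fst_swap, Prod.snd_swap]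
    rw [← hκ.symm (p.2 - p.1), neg_sub, ← neg_sub (r p.1), neg_sq]
  -- The region is the disjoint union of ℝ^d × D and D × Dᶜ. The latter is the mirror image of Dᶜ ×
  -- D, so exterior points count twice and the factor 1/2 of the form restores weight one.
  have hcross : ∫ p in crossSet D, energyDensity κ r p = (∫ y in D, e y) + 2 * ∫ y in Dᶜ, e y := by
    have hdec : crossSet D = Set.univ ×ˢ D ∪ D ×ˢ Dᶜ := by
      ext p; simp [crossSet]; tauto
    have hsub : D ×ˢ Dᶜ ⊆ crossSet D := by rw [hdec]; exact Set.subset_union_right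
    have hdisj : Disjoint (Set.univ ×ˢ D) (D ×ˢ Dᶜ) :=
      Set.disjoint_left.2 fun p h1 h2 => h2.2 h1.2
    conv_lhs => rw [hdec]
    rw [setIntegral_union hdisj (hDm.prod hDm.compl) hU (hEκ.mono_set hsub), hswap, hset, hset,
      Measure.restrict_univ, ← integral_add_compl hDm Ie]
    ring
  have Ig : Integrable g := hκ.integrable_convOn hr.integrable_sq
  have hgc : ∫ y, g y = (∫ h, κ h) * ∫ x in D, r x ^ 2 := hκ.integral_convOn hr.integrable_sq
  have Irf : IntegrableOn (fun y => r y * f y) D := integrable_mul_convOn hκ hr hfin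
  have IrN := integrable_sq_mul_convOn_one hκ hr hfin
  have Ih := integrable_convOn_sq_div hκ hr hfin
  have hDe : ∫ y in D, e y = 2 * (∫ y in D, g y) - 2 * ∫ y in D, r y * f y := by
    have : ∫ y in D, e y = ∫ y in D, (g y - 2 * (r y * f y) + r y ^ 2 * N y) := by
      congr 1; ext y; rw [hee y]; ring
    have Isub : IntegrableOn (fun y => g y - 2 * (r y * f y)) D :=
      Ig.integrableOn.sub (Irf.const_mul 2)
    rw [this, integral_add Isub IrN, integral_sub Ig.integrableOn (Irf.const_mul 2), integral_const_mul,
      integral_sq_mul_convOn_one hκ hr]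
    ring
  -- At an exterior point e(y) = g - 2 r(y) f + r(y)² N is quadratic in the value r(y), with minimum
  -- g - f²/N at r(y) = f/N. This removes the exterior values, over which weak convergence in L²(D)
  -- has no control.
  have hDce : (∫ y in Dᶜ, g y) - ∫ y in Dᶜ, f y ^ 2 / N y ≤ ∫ y in Dᶜ, e y := by
    rw [← integral_sub Ig.integrableOn Ih.integrableOn]
    refine integral_mono (Ig.integrableOn.sub Ih.integrableOn) Ie.integrableOn fun y => ?_
    simp only
    rw [hee y]
    have hN0 : 0 ≤ N y := hκ.convOn_nonneg (fun _ => zero_le_one) y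
    rcases hN0.eq_or_lt with h | h
    · have h2 := convOn_sq_le hκ hr hfin y
      rw [← hN, ← hf, ← h, zero_mul] at h2
      have h3 : f y = 0 := by nlinarith
      rw [← hN, ← hf, ← h, h3]; simp
    · have : r y ^ 2 * N y - 2 * r y * f y + f y ^ 2 / N y = (r y * N y - f y) ^ 2 / N y := by
        field_simp; ring
      have : 0 ≤ (r y * N y - f y) ^ 2 / N y := by positivity
      linarith
  rw [← hgc, ← integral_add_compl hDm Ig]
  linarith

/-- Young's inequality bounds the cross term ∫_D r f by η‖r‖² plus ‖f‖²/(4η), and the latter is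
absorbed into ∫ f²/N; the nonnegative boundary term is added for free. Only one remainder is left,
continuous under weak convergence. -/
lemma coercive_of_isTruncatedKernel (hDm : MeasurableSet D) (hν : IsSymmetricLevyDensity ν)
    (hβ : IsRobinCoefficient D β) (hrF : MemForm ν β D r) {η : ℝ} (hη : 0 < η) :
    ((∫ h, κ h) - η) * ∫ x in D, r x ^ 2 ≤ robinForm ν β D r r +
      (K * (∫ _ in D, (1 : ℝ)) / (4 * η) + 1) *
        ∫ y, convOn κ D r y ^ 2 / convOn κ D (fun _ => 1) y := by
  have h1 := integral_kernel_mul_le hκ hr hfin hDm hrF.aemeasurable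
    ((memForm_iff hν hβ).1 hrF).2.2.1
  have h2 := integral_boundary_nonneg hβ (u := r)
  have h3 : ∫ y in D, r y * convOn κ D r y ≤
      η * (∫ y in D, r y ^ 2) + 1 / (4 * η) * ∫ y in D, convOn κ D r y ^ 2 := by
    rw [← integral_const_mul, ← integral_const_mul,
      ← integral_add (hr.integrable_sq.const_mul _)
        ((integrable_sq_convOn hκ hr hfin).const_mul _)]
    refine integral_mono (integrable_mul_convOn hκ hr hfin)
      ((hr.integrable_sq.const_mul _).add ((integrable_sq_convOn hκ hr hfin).const_mul _))
      fun y => ?_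
    have : η * r y ^ 2 + 1 / (4 * η) * convOn κ D r y ^ 2 - r y * convOn κ D r y =
        (2 * η * r y - convOn κ D r y) ^ 2 / (4 * η) := by field_simp; ring
    have : 0 ≤ (2 * η * r y - convOn κ D r y) ^ 2 / (4 * η) := by positivity
    simp only
    linarith
  have h4 : 1 / (4 * η) * (∫ y in D, convOn κ D r y ^ 2) ≤ 1 / (4 * η) *
      ((K * ∫ _ in D, (1 : ℝ)) * ∫ y, convOn κ D r y ^ 2 / convOn κ D (fun _ => 1) y) :=
    mul_le_mul_of_nonneg_left (integral_sq_convOn_le hκ hr hfin) (by positivity)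
  have h5 : ∫ y in Dᶜ, convOn κ D r y ^ 2 / convOn κ D (fun _ => 1) y ≤
      ∫ y, convOn κ D r y ^ 2 / convOn κ D (fun _ => 1) y :=
    setIntegral_le_integral (integrable_convOn_sq_div hκ hr hfin) (Eventually.of_forall fun y =>
      div_nonneg (sq_nonneg _) (hκ.convOn_nonneg (fun _ => zero_le_one) y))
  rw [robinForm_self_eq]
  have h6 : (K * (∫ _ in D, (1 : ℝ)) / (4 * η) + 1) *
        (∫ y, convOn κ D r y ^ 2 / convOn κ D (fun _ => 1) y) = 1 / (4 * η) *
      ((K * ∫ _ in D, (1 : ℝ)) * ∫ y, convOn κ D r y ^ 2 / convOn κ D (fun _ => 1) y) +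
      ∫ y, convOn κ D r y ^ 2 / convOn κ D (fun _ => 1) y := by ring
  rw [h6]
  linarith

end

end

/-! ### Weak compactness, and minimizing sequences that are Cauchy. -/

section

variable {d : ℕ} {ν β κ : Rd d → ℝ} {D : Set (Rd d)} {u : Rd d → ℝ} {K : ℝ}

lemma inner_toLp {ρ : Measure (Rd d)} {f g : Rd d → ℝ} (hf : MemLp f 2 ρ) (hg : MemLp g 2 ρ) :
    inner ℝ (hf.toLp f) (hg.toLp g) = ∫ x, f x * g x ∂ρ := by
  rw [L2.inner_def]
  refine integral_congr_ae ?_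
  filter_upwards [hf.coeFn_toLp, hg.coeFn_toLp] with x h1 h2
  rw [h1, h2]; simp [mul_comm]

lemma norm_toLp_sq {ρ : Measure (Rd d)} {f : Rd d → ℝ} (hf : MemLp f 2 ρ) :
    ‖hf.toLp f‖ ^ 2 = ∫ x, f x ^ 2 ∂ρ := by
  rw [← real_inner_self_eq_norm_sq, inner_toLp hf hf]
  simp only [sq]

/-- Bounded sequences in `L²` have weakly convergent subsequences. -/
lemma exists_subseq_tendsto_integral_mul {ρ : Measure (Rd d)} [SFinite ρ]
    {us : ℕ → Rd d → ℝ} (hus : ∀ n, MemLp (us n) 2 ρ) {C : ℝ}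
    (hC : ∀ n, ∫ x, us n x ^ 2 ∂ρ ≤ C) :
    ∃ φ : ℕ → ℕ, StrictMono φ ∧ ∀ g, MemLp g 2 ρ →
      ∃ l, Tendsto (fun n => ∫ x, us (φ n) x * g x ∂ρ) atTop (𝓝 l) := by
  have hnorm : ∀ n, ‖(hus n).toLp (us n)‖ ≤ Real.sqrt C := by
    intro n
    refine Real.le_sqrt_of_sq_le ?_
    rw [norm_toLp_sq]
    exact hC n
  have : Fact ((2 : ENNReal) ≠ ⊤) := ⟨by simp⟩
  obtain ⟨a, -, φ, hφ, hlim⟩ := WeakDual.isSeqCompact_closedBall ℝ (Lp ℝ 2 ρ) 0 (Real.sqrt C)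
    (x := fun n => StrongDual.toWeakDual (InnerProductSpace.toDual ℝ (Lp ℝ 2 ρ)
      ((hus n).toLp (us n)))) (fun n => by
        simp only [Set.mem_preimage, mem_closedBall_zero_iff]
        exact ((InnerProductSpace.toDual ℝ (Lp ℝ 2 ρ)).norm_map _).trans_le (hnorm n))
  refine ⟨φ, hφ, fun g hg => ⟨a (hg.toLp g), ?_⟩⟩
  have := ((WeakDual.eval_continuous (hg.toLp g)).tendsto a).comp hlim
  refine this.congr fun n => ?_
  rw [← inner_toLp (hus (φ n)) hg]
  rfl

/-- The truncation of `ν` at height and radius `k`. -/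
noncomputable def truncation (ν : Rd d → ℝ) (k : ℝ) (h : Rd d) : ℝ :=
  (Metric.closedBall 0 k).indicator (fun h => min (ν h) k) h

lemma isTruncatedKernel_truncation (hν : IsSymmetricLevyDensity ν) {k : ℝ} (hk : 0 ≤ k) :
    IsTruncatedKernel ν (truncation ν k) k where
  aemeasurable := (hν.aemeasurable.min aemeasurable_const).indicator measurableSet_closedBall
  nonneg h := Set.indicator_nonneg (fun x _ => le_min (hν.nonneg x) hk) h
  symm h := by
    unfold truncation
    by_cases hh : ‖h‖ ≤ k
    · rw [Set.indicator_of_mem (by simpa using hh), Set.indicator_of_mem (by simpa using hh),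
        hν.symm]
    · rw [Set.indicator_of_notMem (by simpa using hh), Set.indicator_of_notMem (by simpa using hh)]
  le h := Set.indicator_apply_le' (fun _ => min_le_left _ _) (fun _ => hν.nonneg h)
  bounded h := Set.indicator_apply_le' (fun _ => min_le_right _ _) (fun _ => hk)
  support h hh := Set.indicator_of_notMem (by simpa using hh) _

/-- Truncations at height and radius k increase to `ν`, so by monotone convergence their masses
eventually exceed any number below the possibly infinite mass of `ν`. -/
lemma exists_isTruncatedKernel (hν : IsSymmetricLevyDensity ν) {m : ℝ}
    (hm : ENNReal.ofReal m < ∫⁻ h, ENNReal.ofReal (ν h)) :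
    ∃ κ K, IsTruncatedKernel ν κ K ∧ m < ∫ h, κ h := by
  have hT : ∀ k : ℕ, IsTruncatedKernel ν (truncation ν k) k := fun k =>
    isTruncatedKernel_truncation hν k.cast_nonneg
  have hlim : Tendsto (fun k : ℕ => ∫⁻ h, ENNReal.ofReal (truncation ν k h)) atTop
      (𝓝 (∫⁻ h, ENNReal.ofReal (ν h))) := by
    refine lintegral_tendsto_of_tendsto_of_monotone
      (fun k => (hT k).aemeasurable.ennreal_ofReal) (Eventually.of_forall fun h => ?_)
      (Eventually.of_forall fun h => ?_)
    · intro j k hjk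
      refine ENNReal.ofReal_le_ofReal ?_
      refine Set.indicator_apply_le' (fun hj => ?_) fun _ => (hT k).nonneg h
      have hjk' : (j : ℝ) ≤ k := by exact_mod_cast hjk
      rw [truncation, Set.indicator_of_mem (Metric.closedBall_subset_closedBall hjk' hj)]
      exact min_le_min_left _ hjk'
    · refine tendsto_const_nhds.congr' ?_
      obtain ⟨k₀, hk₀⟩ := exists_nat_ge (max ‖h‖ (ν h))
      filter_upwards [eventually_ge_atTop k₀] with k hk
      have hk' : max ‖h‖ (ν h) ≤ k := hk₀.trans (by exact_mod_cast hk)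
      rw [truncation, Set.indicator_of_mem (by simpa using (le_max_left _ _).trans hk'),
        min_eq_left ((le_max_right _ _).trans hk')]
  obtain ⟨k, hk⟩ := (hlim.eventually (lt_mem_nhds hm)).exists
  refine ⟨_, _, hT k, ?_⟩
  rw [← ofReal_integral_eq_lintegral_ofReal (hT k).integrable
    (Eventually.of_forall (hT k).nonneg)] at hk
  exact (ENNReal.ofReal_lt_ofReal_iff'.1 hk).1

/-- Convolution with a truncated kernel turns weak convergence into strong convergence. -/
lemma tendsto_integral_convOn_sub (hκ : IsTruncatedKernel ν κ K)
    (hD : Bornology.IsBounded D) {us : ℕ → Rd d → ℝ}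
    (hus : ∀ n, MemLp (us n) 2 (volume.restrict D)) {C : ℝ}
    (hC : ∀ m n, ∫ x in D, (us m x - us n x) ^ 2 ≤ C)
    (hlim : ∀ y, ∃ l, Tendsto (fun n => convOn κ D (us n) y) atTop (𝓝 l)) :
    Tendsto (fun p : ℕ × ℕ => ∫ y, convOn κ D (fun x => us p.1 x - us p.2 x) y ^ 2 /
      convOn κ D (fun _ => 1) y) (atTop ×ˢ atTop) (𝓝 0) := by
  have hfin : volume D ≠ ⊤ := hD.measure_lt_top.ne
  have : IsFiniteMeasure (volume.restrict D) := ⟨by simpa using hfin.lt_top⟩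
  obtain ⟨R, hR⟩ := hD.subset_closedBall 0
  have hsub : ∀ p : ℕ × ℕ, MemLp (fun x => us p.1 x - us p.2 x) 2 (volume.restrict D) :=
    fun p => (hus p.1).sub (hus p.2)
  have hK : 0 ≤ K := (hκ.nonneg 0).trans (hκ.bounded 0)
  rw [show (0 : ℝ) = ∫ _ : Rd d, (0 : ℝ) by simp]
  -- The dominating function comes from f²/N ≤ κ * (r² 1_D) ≤ K C. It may be cut off at radius R +
  -- K, since κ has range K and D lies in the ball of radius R.
  refine tendsto_integral_filter_of_dominated_convergence
    ((Metric.closedBall (0 : Rd d) (R + K)).indicator fun _ => K * C)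
    (Eventually.of_forall fun p => (integrable_convOn_sq_div hκ (hsub p) hfin).aestronglyMeasurable)
    (Eventually.of_forall fun p => Eventually.of_forall fun y => ?_) ?_
    (Eventually.of_forall fun y => ?_)
  · rw [Real.norm_of_nonneg (div_nonneg (sq_nonneg _)
      (hκ.convOn_nonneg (fun _ => zero_le_one) y))]
    by_cases hy : ‖y‖ ≤ R + K
    · rw [Set.indicator_of_mem (by simpa using hy)]
      refine (convOn_sq_div_le hκ (hsub p) hfin y).trans
        ((hκ.convOn_le (hsub p).integrable_sq (fun _ => sq_nonneg _) y).trans ?_)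
      exact mul_le_mul_of_nonneg_left (hC p.1 p.2) hK
    · rw [Set.indicator_of_notMem (by simpa using hy), hκ.convOn_eq_zero hR (not_le.1 hy)]
      simp
  · exact (integrable_indicator_iff measurableSet_closedBall).2
      (integrableOn_const measure_closedBall_lt_top.ne)
  · obtain ⟨l, hl⟩ := hlim y
    have h1 : Tendsto (fun p : ℕ × ℕ => convOn κ D (us p.1) y - convOn κ D (us p.2) y)
        (atTop ×ˢ atTop) (𝓝 (l - l)) :=
      (hl.comp tendsto_fst).sub (hl.comp tendsto_snd)
    rw [sub_self] at h1
    have h2 : ∀ p : ℕ × ℕ, convOn κ D (fun x => us p.1 x - us p.2 x) y =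
        convOn κ D (us p.1) y - convOn κ D (us p.2) y := fun p => by
      simp only [convOn, sub_mul]
      exact integral_sub (hκ.integrable_mul ((hus p.1).integrable one_le_two) y)
        (hκ.integrable_mul ((hus p.2).integrable one_le_two) y)
    simp only [h2]
    simpa using (h1.pow 2).div_const (convOn κ D (fun _ => 1) y)

/-- A minimizing sequence for the Rayleigh quotient has a subsequence which is Cauchy in `L²(D)`
and for the Robin form, provided that the infimum lies below the mass of `ν`. -/
lemma exists_subseq_cauchy (hν : IsSymmetricLevyDensity ν) (hβ : IsRobinCoefficient D β)
    (hDm : MeasurableSet D) (hD : Bornology.IsBounded D) {m : ℝ}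
    (hm : ∀ u, MemForm ν β D u → m * ∫ x in D, u x ^ 2 ≤ robinForm ν β D u u)
    (hlt : ENNReal.ofReal m < ∫⁻ h, ENNReal.ofReal (ν h)) {us : ℕ → Rd d → ℝ}
    (hus : ∀ n, MemForm ν β D (us n)) (h1 : ∀ n, ∫ x in D, us n x ^ 2 = 1)
    (hQ : Tendsto (fun n => robinForm ν β D (us n) (us n)) atTop (𝓝 m)) :
    ∃ φ : ℕ → ℕ, StrictMono φ ∧
      Tendsto (fun p : ℕ × ℕ => ∫ x in D, (us (φ p.1) x - us (φ p.2) x) ^ 2)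
        (atTop ×ˢ atTop) (𝓝 0) ∧
      Tendsto (fun p : ℕ × ℕ => robinForm ν β D (fun x => us (φ p.1) x - us (φ p.2) x)
        (fun x => us (φ p.1) x - us (φ p.2) x)) (atTop ×ˢ atTop) (𝓝 0) := by
  obtain ⟨κ, K, hκ, hmκ⟩ := exists_isTruncatedKernel hν hlt
  have hfin : volume D ≠ ⊤ := hD.measure_lt_top.ne
  have : IsFiniteMeasure (volume.restrict D) := ⟨by simpa using hfin.lt_top⟩
  obtain ⟨φ, hφ, hw⟩ := exists_subseq_tendsto_integral_mul (fun n => (hus n).memLp)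
    (fun n => (h1 n).le)
  refine ⟨φ, hφ, ?_⟩
  set vs : ℕ → Rd d → ℝ := fun n => us (φ n) with hvs
  have hv : ∀ n, MemForm ν β D (vs n) := fun n => hus _
  have hv1 : ∀ n, ∫ x in D, vs n x ^ 2 = 1 := fun n => h1 _
  have hvQ : Tendsto (fun n => robinForm ν β D (vs n) (vs n)) atTop (𝓝 m) :=
    hQ.comp hφ.tendsto_atTop
  set dd : ℕ × ℕ → Rd d → ℝ := fun p x => vs p.1 x - vs p.2 x with hdd
  have hd : ∀ p, MemForm ν β D (dd p) := fun p => (hv p.1).sub hν hβ (hv p.2)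
  -- Parallelogram law in L²(D) for two unit vectors.
  have hsum : ∀ p : ℕ × ℕ, (∫ x in D, dd p x ^ 2) + ∫ x in D, (vs p.1 x + vs p.2 x) ^ 2 = 4 := by
    intro p
    have e := (hv p.1).memLp.integrable_sq.const_mul 2
    have e' := (hv p.2).memLp.integrable_sq.const_mul 2
    rw [← integral_add (hd p).memLp.integrable_sq
      ((hv p.1).add hν hβ (hv p.2)).memLp.integrable_sq]
    have : ∫ x in D, (dd p x ^ 2 + (vs p.1 x + vs p.2 x) ^ 2) =
        ∫ x in D, (2 * vs p.1 x ^ 2 + 2 * vs p.2 x ^ 2) := by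
      congr 1; ext x; simp only [hdd]; ring
    rw [this, integral_add e e', integral_const_mul, integral_const_mul, hv1, hv1]
    norm_num
  -- Parallelogram law for Q, with Q of the sum bounded below by m times its squared norm, that is
  -- by m(4 - ‖d‖²).
  have hpar : ∀ p : ℕ × ℕ, robinForm ν β D (dd p) (dd p) ≤ m * (∫ x in D, dd p x ^ 2) +
      (2 * (robinForm ν β D (vs p.1) (vs p.1) - m) +
        2 * (robinForm ν β D (vs p.2) (vs p.2) - m)) := by
    intro p
    have hs := (hv p.1).add hν hβ (hv p.2)
    have e1 := hm _ hs
    have e2 : robinForm ν β D (dd p) (dd p) = robinForm ν β D (vs p.1) (vs p.1) -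
        2 * robinForm ν β D (vs p.1) (vs p.2) + robinForm ν β D (vs p.2) (vs p.2) := by
      rw [robinForm_sub_left hν hβ (hv p.1) (hv p.2) (hd p),
        robinForm_sub_right hν hβ (hv p.1) (hv p.2) (hv p.1),
        robinForm_sub_right hν hβ (hv p.1) (hv p.2) (hv p.2),
        robinForm_comm (u := vs p.2) (v := vs p.1)]
      ring
    rw [robinForm_add_left hν hβ (hv p.1) (hv p.2) hs,
        robinForm_add_right hν hβ (hv p.1) (hv p.2) (hv p.1),
        robinForm_add_right hν hβ (hv p.1) (hv p.2) (hv p.2),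
        robinForm_comm (u := vs p.2) (v := vs p.1)] at e1
    have := hsum p
    rw [← eq_sub_iff_add_eq'] at this
    rw [this] at e1
    linarith
  -- For fixed y the function κ(y - ·) is bounded on a set of finite measure, hence an admissible L²
  -- test function for weak convergence.
  have hconv : ∀ y, ∃ l, Tendsto (fun n => convOn κ D (vs n) y) atTop (𝓝 l) := by
    intro y
    refine hw (fun x => κ (y - x)) ?_
    refine MemLp.of_bound (aestronglyMeasurable_shift hκ.aemeasurable y).restrict K
      (Eventually.of_forall fun x => ?_)
    rw [Real.norm_of_nonneg (hκ.nonneg _)]; exact hκ.bounded _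
  have hle4 : ∀ p : ℕ × ℕ, ∫ x in D, dd p x ^ 2 ≤ 4 := fun p => by
    have : 0 ≤ ∫ x in D, (vs p.1 x + vs p.2 x) ^ 2 := integral_nonneg fun _ => sq_nonneg _
    linarith [hsum p]
  have hT := tendsto_integral_convOn_sub hκ hD (fun n => (hv n).memLp)
    (fun a b => hle4 (a, b)) hconv
  set H : ℕ × ℕ → ℝ := fun p => ∫ y, convOn κ D (dd p) y ^ 2 / convOn κ D (fun _ => 1) y with hH
  -- Half the gap: then ∫κ - η = m + η, and subtracting m‖d‖² from both sides leaves η‖d‖² bounded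
  -- by terms that vanish.
  set η : ℝ := ((∫ h, κ h) - m) / 2 with hη
  have hη0 : 0 < η := by rw [hη]; linarith
  set C : ℝ := K * (∫ _ in D, (1 : ℝ)) / (4 * η) + 1 with hCdef
  have hErr : Tendsto (fun p : ℕ × ℕ => 2 * (robinForm ν β D (vs p.1) (vs p.1) - m) +
        2 * (robinForm ν β D (vs p.2) (vs p.2) - m)) (atTop ×ˢ atTop) (𝓝 0) := by
    have a : Tendsto (fun p : ℕ × ℕ => robinForm ν β D (vs p.1) (vs p.1)) (atTop ×ˢ atTop) (𝓝 m) :=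
      hvQ.comp tendsto_fst
    have b : Tendsto (fun p : ℕ × ℕ => robinForm ν β D (vs p.2) (vs p.2)) (atTop ×ˢ atTop) (𝓝 m) :=
      hvQ.comp tendsto_snd
    simpa using ((a.sub_const m).const_mul 2).add ((b.sub_const m).const_mul 2)
  have hdlim : Tendsto (fun p => ∫ x in D, dd p x ^ 2) (atTop ×ˢ atTop) (𝓝 0) := by
    have hup : Tendsto (fun p => η⁻¹ * ((2 * (robinForm ν β D (vs p.1) (vs p.1) - m) +
        2 * (robinForm ν β D (vs p.2) (vs p.2) - m)) + C * H p)) (atTop ×ˢ atTop) (𝓝 0) := by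
      simpa using (hErr.add (hT.const_mul C)).const_mul η⁻¹
    refine squeeze_zero (fun p => integral_nonneg fun _ => sq_nonneg _) (fun p => ?_) hup
    have e1 := coercive_of_isTruncatedKernel hκ (hd p).memLp hfin hDm hν hβ (hd p) hη0
    have e2 := hpar p
    rw [← hCdef] at e1
    rw [le_inv_mul_iff₀ hη0]
    have e3 : (∫ h, κ h) = m + 2 * η := by rw [hη]; ring
    rw [e3] at e1
    simp only [hH]
    linarith
  refine ⟨hdlim, ?_⟩
  refine squeeze_zero (fun p => robinForm_self_nonneg hν hβ) hpar ?_
  simpa using (hdlim.const_mul m).add hErr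

end

/-! ### A weighted L² space on ℝ^d, and existence of a minimizer. -/

section

variable {d : ℕ} {ν β κ : Rd d → ℝ} {D : Set (Rd d)} {u r : Rd d → ℝ}

/-- An integrable minorant of `ν`. -/
noncomputable def levyWeight (ν : Rd d → ℝ) (h : Rd d) : ℝ := min 1 (‖h‖ ^ 2) * ν h

lemma levyWeight_nonneg (hν : IsSymmetricLevyDensity ν) (h : Rd d) : 0 ≤ levyWeight ν h :=
  mul_nonneg (le_min zero_le_one (sq_nonneg _)) (hν.nonneg h)

lemma levyWeight_le (hν : IsSymmetricLevyDensity ν) (h : Rd d) : levyWeight ν h ≤ ν h :=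
  mul_le_of_le_one_left (hν.nonneg h) (min_le_left _ _)

/-- The density of a measure on `ℝ^d`, equivalent to Lebesgue measure, whose `L²` norm is
controlled by the Robin form together with the `L²(D)` norm. -/
noncomputable def formWeight (ν : Rd d → ℝ) (D : Set (Rd d)) (y : Rd d) : ENNReal :=
  D.indicator 1 y + ∫⁻ x in D, ENNReal.ofReal (levyWeight ν (y - x))

/-- The measure with density `formWeight`. -/
noncomputable def formMeasure (ν : Rd d → ℝ) (D : Set (Rd d)) : Measure (Rd d) :=
  volume.withDensity (formWeight ν D)

lemma aemeasurable_levyWeight (hν : IsSymmetricLevyDensity ν) :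
    AEMeasurable (levyWeight ν) volume :=
  hν.integrable.aestronglyMeasurable.aemeasurable

lemma aemeasurable_levyWeight_prod (hν : IsSymmetricLevyDensity ν) :
    AEMeasurable (fun p : Rd d × Rd d => levyWeight ν (p.1 - p.2))
      (volume.prod (volume.restrict D)) := by
  have := aemeasurable_kernel (aemeasurable_levyWeight hν)
  rw [Measure.volume_eq_prod] at this
  exact this.mono_measure (Measure.prod_mono le_rfl Measure.restrict_le_self)

lemma aemeasurable_formWeight (hν : IsSymmetricLevyDensity ν) (hDm : MeasurableSet D) :
    AEMeasurable (formWeight ν D) volume := by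
  refine AEMeasurable.add (measurable_one.indicator hDm).aemeasurable ?_
  exact (aemeasurable_levyWeight_prod hν).ennreal_ofReal.lintegral_prod_right'

lemma restrict_le_formMeasure (hDm : MeasurableSet D) :
    volume.restrict D ≤ formMeasure ν D := by
  rw [← withDensity_indicator_one hDm]
  exact withDensity_mono (Eventually.of_forall fun y => le_self_add)

/-- The density is positive at every y, being an integral over the non-null set D of a function
positive almost everywhere. The factor |h|² vanishes at the origin, which is a null set because the
space is nontrivial. -/
lemma volume_absolutelyContinuous_formMeasure [Nontrivial (Rd d)]
    (hν : IsSymmetricLevyDensity ν) (hDm : MeasurableSet D) (hpos : volume D ≠ 0) :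
    volume ≪ formMeasure ν D := by
  refine withDensity_absolutelyContinuous' (aemeasurable_formWeight hν hDm)
    (Eventually.of_forall fun y h0 => hpos ?_)
  have h1 : ∫⁻ x in D, ENNReal.ofReal (levyWeight ν (y - x)) = 0 :=
    le_antisymm (le_add_self.trans_eq h0) bot_le
  have hm : AEMeasurable (fun x => levyWeight ν (y - x)) volume :=
    (aestronglyMeasurable_shift (aemeasurable_levyWeight hν) y).aemeasurable
  rw [lintegral_eq_zero_iff' hm.restrict.ennreal_ofReal] at h1
  have h2 : ∀ᵐ h ∂(volume : Measure (Rd d)), 0 < levyWeight ν h := by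
    filter_upwards [hν.pos, Measure.ae_ne volume (0 : Rd d)] with h h3 h4
    have : 0 < ‖h‖ := norm_pos_iff.2 h4
    exact mul_pos (lt_min one_pos (by positivity)) h3
  have h3 := (quasiMeasurePreserving_sub_left_of_right_invariant volume y).ae h2
  have h4 : ∀ᵐ x ∂(volume.restrict D), False := by
    filter_upwards [h1, ae_restrict_of_ae h3] with x h5 h6
    exact (ENNReal.ofReal_pos.2 h6).ne' h5
  simpa using h4

/-- The values of r off D are reached through those in D: r(y)² ≤ 2(r(y) - r(x))² + 2r(x)²,
integrated against the Lévy weight over x in D. The first term is part of the energy; the second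
factorizes since the weight is integrable. -/
lemma lintegral_formMeasure_le (hν : IsSymmetricLevyDensity ν) (hβ : IsRobinCoefficient D β)
    (hDm : MeasurableSet D) (hr : MemForm ν β D r) :
    ∫⁻ y, ENNReal.ofReal (r y ^ 2) ∂(formMeasure ν D) ≤
      ENNReal.ofReal ((1 + 2 * ∫ h, levyWeight ν h) * (∫ x in D, r x ^ 2) +
        4 * robinForm ν β D r r) := by
  have hE := ((memForm_iff hν hβ).1 hr).2.2.1
  have hsub : Set.univ ×ˢ D ⊆ crossSet D := by rw [crossSet_eq]; exact Set.subset_union_right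
  have hprod : (volume : Measure (Rd d × Rd d)).restrict (Set.univ ×ˢ D) =
      volume.prod (volume.restrict D) := by
    rw [Measure.volume_eq_prod, ← Measure.prod_restrict, Measure.restrict_univ]
  have I1 : Integrable (energyDensity ν r) (volume.prod (volume.restrict D)) := by
    rw [← hprod]; exact hE.mono_set hsub
  have I2 : Integrable (fun p : Rd d × Rd d => r p.2 ^ 2 * levyWeight ν (p.1 - p.2))
      (volume.prod (volume.restrict D)) :=
    integrable_prod_conv hr.memLp.integrable_sq hν.integrable
  have E2 : ∫ p, r p.2 ^ 2 * levyWeight ν (p.1 - p.2) ∂(volume.prod (volume.restrict D)) =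
      (∫ h, levyWeight ν h) * ∫ x in D, r x ^ 2 :=
    integral_prod_conv hr.memLp.integrable_sq hν.integrable
  have E1 : ∫ p, energyDensity ν r p ∂(volume.prod (volume.restrict D)) ≤
      2 * robinForm ν β D r r := by
    rw [← hprod, robinForm_self_eq]
    have a := setIntegral_mono_set hE
      (Eventually.of_forall (energyDensity_nonneg hν.nonneg)) hsub.eventuallyLE
    have b := integral_boundary_nonneg hβ (u := r)
    linarith
  have hm : AEMeasurable (fun y => ENNReal.ofReal (r y ^ 2)) volume :=
    (hr.aemeasurable.pow_const 2).ennreal_ofReal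
  have hm1 : AEMeasurable (fun y => D.indicator 1 y * ENNReal.ofReal (r y ^ 2)) volume :=
    (measurable_one.indicator hDm).aemeasurable.mul hm
  have hA : ∫⁻ y, D.indicator 1 y * ENNReal.ofReal (r y ^ 2) =
      ENNReal.ofReal (∫ x in D, r x ^ 2) := by
    rw [ofReal_integral_eq_lintegral_ofReal hr.memLp.integrable_sq
      (Eventually.of_forall fun _ => sq_nonneg _), ← lintegral_indicator hDm]
    congr 1; ext y
    by_cases hy : y ∈ D <;> simp [hy]
  have hB : ∫⁻ y, (∫⁻ x in D, ENNReal.ofReal (levyWeight ν (y - x))) * ENNReal.ofReal (r y ^ 2) ≤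
      ENNReal.ofReal (2 * (∫ p, energyDensity ν r p ∂(volume.prod (volume.restrict D))) +
        2 * ((∫ h, levyWeight ν h) * ∫ x in D, r x ^ 2)) := by
    have I3 : Integrable (fun p : Rd d × Rd d => 2 * energyDensity ν r p +
        2 * (r p.2 ^ 2 * levyWeight ν (p.1 - p.2))) (volume.prod (volume.restrict D)) :=
      (I1.const_mul 2).add (I2.const_mul 2)
    have h0 : ∀ p : Rd d × Rd d, 0 ≤ 2 * energyDensity ν r p +
        2 * (r p.2 ^ 2 * levyWeight ν (p.1 - p.2)) := fun p => by
      have := energyDensity_nonneg hν.nonneg (u := r) p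
      have := levyWeight_nonneg hν (p.1 - p.2)
      positivity
    rw [← E2, ← integral_const_mul, ← integral_const_mul,
      ← integral_add (I1.const_mul 2) (I2.const_mul 2),
      ofReal_integral_eq_lintegral_ofReal I3 (Eventually.of_forall h0),
      lintegral_prod _ I3.aestronglyMeasurable.aemeasurable.ennreal_ofReal]
    refine lintegral_mono fun y => ?_
    rw [← lintegral_mul_const' _ _ ENNReal.ofReal_ne_top]
    refine lintegral_mono fun x => ?_
    simp only
    rw [← ENNReal.ofReal_mul (levyWeight_nonneg hν _)]
    refine ENNReal.ofReal_le_ofReal ?_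
    simp only [energyDensity]
    have h1 : (r y - r x) ^ 2 * levyWeight ν (y - x) ≤ (r y - r x) ^ 2 * ν (y - x) :=
      mul_le_mul_of_nonneg_left (levyWeight_le hν _) (sq_nonneg _)
    have h2 : r y ^ 2 * levyWeight ν (y - x) ≤
        (2 * (r y - r x) ^ 2 + 2 * r x ^ 2) * levyWeight ν (y - x) :=
      mul_le_mul_of_nonneg_right (by nlinarith [sq_nonneg (r y - 2 * r x)])
        (levyWeight_nonneg hν _)
    linarith
  rw [formMeasure, lintegral_withDensity_eq_lintegral_mul₀ (aemeasurable_formWeight hν hDm) hm]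
  simp only [Pi.mul_apply, formWeight, add_mul]
  rw [lintegral_add_left' hm1, hA]
  refine (add_le_add_right hB _).trans ?_
  rw [← ENNReal.ofReal_add (integral_nonneg fun _ => sq_nonneg _)]
  · refine ENNReal.ofReal_le_ofReal ?_
    linarith
  · have : 0 ≤ ∫ p, energyDensity ν r p ∂(volume.prod (volume.restrict D)) :=
      integral_nonneg (energyDensity_nonneg hν.nonneg)
    have : 0 ≤ ∫ h, levyWeight ν h := integral_nonneg (levyWeight_nonneg hν)
    have : 0 ≤ ∫ x in D, r x ^ 2 := integral_nonneg fun _ => sq_nonneg _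
    positivity

lemma MemForm.memLp_formMeasure (hν : IsSymmetricLevyDensity ν) (hβ : IsRobinCoefficient D β)
    (hDm : MeasurableSet D) (hr : MemForm ν β D r) : MemLp r 2 (formMeasure ν D) := by
  have hm : AEMeasurable r (formMeasure ν D) :=
    hr.aemeasurable.mono_ac (withDensity_absolutelyContinuous _ _)
  rw [memLp_two_iff_integrable_sq hm.aestronglyMeasurable,
    ← lintegral_ofReal_ne_top_iff_integrable (hm.pow_const 2).aestronglyMeasurable
      (Eventually.of_forall fun _ => sq_nonneg _)]
  exact ((lintegral_formMeasure_le hν hβ hDm hr).trans_lt ENNReal.ofReal_lt_top).ne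

lemma integral_formMeasure_le (hν : IsSymmetricLevyDensity ν) (hβ : IsRobinCoefficient D β)
    (hDm : MeasurableSet D) (hr : MemForm ν β D r) :
    ∫ y, r y ^ 2 ∂(formMeasure ν D) ≤ (1 + 2 * ∫ h, levyWeight ν h) * (∫ x in D, r x ^ 2) +
        4 * robinForm ν β D r r := by
  have h := lintegral_formMeasure_le hν hβ hDm hr
  rw [← ofReal_integral_eq_lintegral_ofReal
    (hr.memLp_formMeasure hν hβ hDm).integrable_sq (Eventually.of_forall fun _ => sq_nonneg _)] at h
  refine (ENNReal.ofReal_le_ofReal_iff ?_).1 h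
  have : 0 ≤ ∫ h, levyWeight ν h := integral_nonneg (levyWeight_nonneg hν)
  have : 0 ≤ ∫ x in D, r x ^ 2 := integral_nonneg fun _ => sq_nonneg _
  have := robinForm_self_nonneg hν hβ (u := r)
  positivity

/-- A sequence which is Cauchy in `L²(D)` and for the Robin form has a limit in `L²(D)` which is
an almost everywhere limit of a subsequence in the whole space. -/
lemma exists_tendsto_of_cauchy [Nontrivial (Rd d)] (hν : IsSymmetricLevyDensity ν)
    (hβ : IsRobinCoefficient D β) (hDm : MeasurableSet D) (hpos : volume D ≠ 0)
    {vs : ℕ → Rd d → ℝ} (hv : ∀ n, MemForm ν β D (vs n))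
    (h1 : Tendsto (fun p : ℕ × ℕ => ∫ x in D, (vs p.1 x - vs p.2 x) ^ 2) (atTop ×ˢ atTop) (𝓝 0))
    (h2 : Tendsto (fun p : ℕ × ℕ => robinForm ν β D (fun x => vs p.1 x - vs p.2 x)
        (fun x => vs p.1 x - vs p.2 x)) (atTop ×ˢ atTop) (𝓝 0)) :
    ∃ u : Rd d → ℝ, ∃ φ : ℕ → ℕ, StrictMono φ ∧
      (∀ᵐ x, Tendsto (fun n => vs (φ n) x) atTop (𝓝 (u x))) ∧
      Tendsto (fun n => ∫ x in D, vs n x ^ 2) atTop (𝓝 (∫ x in D, u x ^ 2)) := by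
  set ρ := formMeasure ν D with hρ
  have hL : ∀ n, MemLp (vs n) 2 ρ := fun n => (hv n).memLp_formMeasure hν hβ hDm
  have hcau : CauchySeq fun n => (hL n).toLp (vs n) := by
    rw [cauchySeq_iff_tendsto_dist_atTop_0, ← prod_atTop_atTop_eq]
    have hup : Tendsto (fun p : ℕ × ℕ => Real.sqrt ((1 + 2 * ∫ h, levyWeight ν h) *
        (∫ x in D, (vs p.1 x - vs p.2 x) ^ 2) + 4 * robinForm ν β D (fun x => vs p.1 x - vs p.2 x)
        (fun x => vs p.1 x - vs p.2 x))) (atTop ×ˢ atTop) (𝓝 0) := by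
      have := ((h1.const_mul (1 + 2 * ∫ h, levyWeight ν h)).add (h2.const_mul 4)).sqrt
      simpa using this
    refine squeeze_zero (fun p => dist_nonneg) (fun p => ?_) hup
    refine Real.le_sqrt_of_sq_le ?_
    rw [dist_eq_norm, ← MemLp.toLp_sub, norm_toLp_sq]
    exact integral_formMeasure_le hν hβ hDm ((hv p.1).sub hν hβ (hv p.2))
  obtain ⟨F, hF⟩ := cauchySeq_tendsto_of_complete hcau
  obtain ⟨u, hu, rfl⟩ : ∃ u, ∃ hu : MemLp u 2 ρ, hu.toLp u = F :=
    ⟨F, Lp.memLp F, Lp.toLp_coeFn F (Lp.memLp F)⟩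
  obtain ⟨φ, hφ, hae⟩ := (tendstoInMeasure_of_tendsto_Lp hF).exists_seq_tendsto_ae
  refine ⟨u, φ, hφ, ?_, ?_⟩
  · refine volume_absolutelyContinuous_formMeasure hν hDm hpos ?_
    have hco : ∀ᵐ x ∂ρ, ∀ n, (hL n).toLp (vs n) x = vs n x :=
      ae_all_iff.2 fun n => (hL n).coeFn_toLp
    filter_upwards [hae, hco, hu.coeFn_toLp] with x h3 h4 h5
    simpa only [h4, h5] using h3
  · have hle : volume.restrict D ≤ ρ := restrict_le_formMeasure hDm
    have e1 := (Lp.tendsto_Lp_iff_tendsto_eLpNorm'' vs hL u hu).1 hF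
    have e2 : Tendsto (fun n => eLpNorm (vs n - u) 2 (volume.restrict D)) atTop (𝓝 0) :=
      tendsto_of_tendsto_of_tendsto_of_le_of_le tendsto_const_nhds e1 (fun _ => bot_le)
        (fun n => eLpNorm_mono_measure _ hle)
    have e3 := (Lp.tendsto_Lp_iff_tendsto_eLpNorm'' vs (fun n => (hv n).memLp) u
      (hu.mono_measure hle)).2 e2
    have e4 := e3.norm.pow 2
    simpa only [norm_toLp_sq] using e4

/-- The infimum of the Rayleigh quotient is attained if it lies below the mass of `ν`. -/
lemma exists_minimizer [Nontrivial (Rd d)] (hν : IsSymmetricLevyDensity ν)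
    (hβ : IsRobinCoefficient D β) (hDm : MeasurableSet D) (hD : Bornology.IsBounded D)
    (hpos : volume D ≠ 0) {m : ℝ}
    (hm : ∀ u, MemForm ν β D u → m * ∫ x in D, u x ^ 2 ≤ robinForm ν β D u u)
    (hlt : ENNReal.ofReal m < ∫⁻ h, ENNReal.ofReal (ν h)) {us : ℕ → Rd d → ℝ}
    (hus : ∀ n, MemForm ν β D (us n)) (h1 : ∀ n, ∫ x in D, us n x ^ 2 = 1)
    (hQ : Tendsto (fun n => robinForm ν β D (us n) (us n)) atTop (𝓝 m)) :
    ∃ u, MemForm ν β D u ∧ ∫ x in D, u x ^ 2 = 1 ∧ robinForm ν β D u u = m := by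
  obtain ⟨φ, hφ, hc1, hc2⟩ := exists_subseq_cauchy hν hβ hDm hD hm hlt hus h1 hQ
  obtain ⟨u, ψ, hψ, hae, hn⟩ := exists_tendsto_of_cauchy hν hβ hDm hpos
    (fun n => hus (φ n)) hc1 hc2
  have hu1 : ∫ x in D, u x ^ 2 = 1 := by
    simp only [h1] at hn
    exact tendsto_nhds_unique hn tendsto_const_nhds
  -- Convergence in L²(D) keeps the norm equal to one, while the form can only drop in the limit;
  -- the lower bound by m then excludes a drop.
  obtain ⟨hmem, hle⟩ := MemForm.of_tendsto_ae hν hβ (fun n => hus (φ (ψ n))) hae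
    (hQ.comp (hφ.comp hψ).tendsto_atTop) (fun n => le_rfl) (fun n => (h1 _).le)
  have := hm u hmem
  rw [hu1, mul_one] at this
  exact ⟨u, hmem, hu1, le_antisymm hle this⟩

end

/-! ### First variation, the strong minimum principle, and strict positivity of the form. -/

section

variable {d : ℕ} {ν β κ : Rd d → ℝ} {D : Set (Rd d)} {u w : Rd d → ℝ} {m : ℝ}

lemma eLpNorm_eq_one_iff {ρ : Measure (Rd d)} (hu : MemLp u 2 ρ) :
    eLpNorm u 2 ρ = 1 ↔ ∫ x, u x ^ 2 ∂ρ = 1 := by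
  rw [← norm_toLp_sq hu, Lp.norm_toLp, pow_eq_one_iff_of_nonneg ENNReal.toReal_nonneg two_ne_zero,
    ENNReal.toReal_eq_one_iff]

lemma ae_eq_zero_iff_integral_sq {ρ : Measure (Rd d)} (hu : MemLp u 2 ρ) :
    (∀ᵐ x ∂ρ, u x = 0) ↔ ∫ x, u x ^ 2 ∂ρ = 0 := by
  rw [integral_eq_zero_iff_of_nonneg (fun _ => sq_nonneg _) hu.integrable_sq]
  refine eventually_congr (Eventually.of_forall fun x => ?_)
  simp

/-- Minimizers of the Rayleigh quotient satisfy the weak eigenvalue equation. -/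
lemma robinForm_eq_of_minimizer (hν : IsSymmetricLevyDensity ν) (hβ : IsRobinCoefficient D β)
    (hm : ∀ u, MemForm ν β D u → m * ∫ x in D, u x ^ 2 ≤ robinForm ν β D u u)
    (hu : MemForm ν β D u) (hQ : robinForm ν β D u u = m * ∫ x in D, u x ^ 2)
    (hw : MemForm ν β D w) : robinForm ν β D u w = m * ∫ x in D, u x * w x := by
  have Iuw : IntegrableOn (fun x => u x * w x) D := hu.memLp.integrable_mul hw.memLp
  -- The function Q - m‖·‖² is nonnegative along u + t w and vanishes at t = 0. A nonnegative
  -- quadratic without constant term has no linear term.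
  have key : ∀ t : ℝ, 0 ≤ (robinForm ν β D w w - m * ∫ x in D, w x ^ 2) * (t * t) +
      (2 * (robinForm ν β D u w - m * ∫ x in D, u x * w x)) * t + 0 := by
    intro t
    have htw := hw.const_mul hν hβ t
    have h := hm _ (hu.add hν hβ htw)
    rw [robinForm_add_left hν hβ hu htw (hu.add hν hβ htw),
      robinForm_add_right hν hβ hu htw hu, robinForm_add_right hν hβ hu htw htw,
      robinForm_const_mul_left, robinForm_const_mul_left, robinForm_const_mul_right,
      robinForm_const_mul_right, robinForm_comm (u := w) (v := u)] at h
    have e : ∫ x in D, (u x + t * w x) ^ 2 = (∫ x in D, u x ^ 2) +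
        (2 * t * (∫ x in D, u x * w x) + t ^ 2 * ∫ x in D, w x ^ 2) := by
      rw [← integral_const_mul, ← integral_const_mul,
        ← integral_add (Iuw.const_mul _) (hw.memLp.integrable_sq.const_mul _),
        ← integral_add hu.memLp.integrable_sq]
      · congr 1; ext x; ring
      · exact (Iuw.const_mul _).add (hw.memLp.integrable_sq.const_mul _)
    rw [e] at h
    nlinarith
  have := discrim_le_zero key
  unfold discrim at this
  nlinarith [sq_nonneg (robinForm ν β D u w - m * ∫ x in D, u x * w x)]

lemma robinForm_abs_le (hν : IsSymmetricLevyDensity ν) (hβ : IsRobinCoefficient D β)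
    (hu : MemForm ν β D u) :
    robinForm ν β D (fun x => |u x|) (fun x => |u x|) ≤ robinForm ν β D u u := by
  have h1 : ∫ p in crossSet D, energyDensity ν (fun x => |u x|) p ≤
      ∫ p in crossSet D, energyDensity ν u p := by
    refine integral_mono ((memForm_iff hν hβ).1 (hu.abs hν hβ)).2.2.1
      ((memForm_iff hν hβ).1 hu).2.2.1 fun p => ?_
    exact mul_le_mul_of_nonneg_right (sq_le_sq.2 (abs_abs_sub_abs_le_abs_sub _ _)) (hν.nonneg _)
  rw [robinForm_self_eq, robinForm_self_eq]
  simp only [sq_abs]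
  linarith

/-- Pointwise (a⁺ - b⁺)² ≤ (a - b)(a⁺ - b⁺), with equality a⁺a⁺ = a a⁺ in the boundary term. -/
lemma robinForm_posPart_le (hν : IsSymmetricLevyDensity ν) (hβ : IsRobinCoefficient D β)
    (hu : MemForm ν β D u) :
    robinForm ν β D (fun x => max (u x) 0) (fun x => max (u x) 0) ≤
      robinForm ν β D u (fun x => max (u x) 0) := by
  have hp := hu.posPart hν hβ
  have h1 := integral_mono (hp.integrable_energy hν hβ hp) (hu.integrable_energy hν hβ hp)
    fun p => by
      refine mul_le_mul_of_nonneg_right ?_ (hν.nonneg _)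
      rcases le_total (u p.1) 0 with h1 | h1 <;> rcases le_total (u p.2) 0 with h2 | h2 <;>
        simp only [h1, h2, max_eq_left, max_eq_right] <;> nlinarith
  have h2 : ∫ y in Dᶜ, β y * max (u y) 0 * max (u y) 0 = ∫ y in Dᶜ, β y * u y * max (u y) 0 := by
    congr 1; ext y
    rcases le_total (u y) 0 with h | h
    · simp [h]
    · simp [h]
  simp only [robinForm, energyForm, ← crossSet.eq_1] at *
  rw [h2]
  linarith

/-- If `u` is a nonnegative weak supersolution, then truncating a nonnegative function of the form
domain to the zero set of `u` stays in the form domain. -/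
lemma memForm_mul_indicator_zero (hν : IsSymmetricLevyDensity ν) (hβ : IsRobinCoefficient D β)
    (hu : MemForm ν β D u) (hu0 : ∀ x, 0 ≤ u x) (hw : MemForm ν β D w) (hw0 : ∀ x, 0 ≤ w x)
    (hsuper : ∀ v, MemForm ν β D v → (∀ x, 0 ≤ v x) → 0 ≤ robinForm ν β D u v) :
    MemForm ν β D ({x | u x = 0}.indicator w) := by
  have hn : ∀ n : ℕ, MemForm ν β D (fun x => w x - n * u x) := fun n =>
    hw.sub hν hβ (hu.const_mul hν hβ n)
  have hp : ∀ n : ℕ, MemForm ν β D (fun x => max (w x - n * u x) 0) := fun n =>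
    (hn n).posPart hν hβ
  refine (MemForm.of_tendsto_ae hν hβ hp (Eventually.of_forall fun x => ?_)
    (tendsto_const_nhds (x := robinForm ν β D w w)) (fun n => ?_)
    (M := ∫ x in D, w x ^ 2) (fun n => ?_)).1
  -- The approximants (w - n u)⁺ equal w on the zero set of u and are eventually 0 elsewhere.
  · by_cases hx : u x = 0
    · rw [Set.indicator_of_mem (by simpa using hx)]
      simp [hx, hw0 x]
    · rw [Set.indicator_of_notMem (by simpa using hx)]
      refine tendsto_const_nhds.congr' ?_
      have hpos : 0 < u x := lt_of_le_of_ne (hu0 x) (Ne.symm hx)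
      obtain ⟨N, hN⟩ := exists_nat_ge (w x / u x)
      filter_upwards [eventually_ge_atTop N] with n hn
      have : w x / u x ≤ n := hN.trans (by exact_mod_cast hn)
      rw [div_le_iff₀ hpos] at this
      rw [max_eq_right (by linarith)]
  -- With p = (w - n u)⁺, the supersolution property gives Q(p,p) ≤ Q(w,p) - n Q(u,p) ≤ Q(w,p), and
  -- Q(w - p, w - p) ≥ 0 turns this into Q(p,p) ≤ Q(w,w), uniformly in n.
  · have h1 := robinForm_posPart_le hν hβ (hn n)
    rw [robinForm_sub_left hν hβ hw (hu.const_mul hν hβ n) (hp n),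
      robinForm_const_mul_left] at h1
    have h2 := mul_nonneg (Nat.cast_nonneg (α := ℝ) n)
      (hsuper _ (hp n) fun x => le_max_right _ _)
    have h3 := robinForm_self_nonneg hν hβ (u := fun x => w x - max (w x - n * u x) 0)
    rw [robinForm_sub_left hν hβ hw (hp n) (hw.sub hν hβ (hp n)),
      robinForm_sub_right hν hβ hw (hp n) hw, robinForm_sub_right hν hβ hw (hp n) (hp n),
      robinForm_comm (u := fun x => max (w x - n * u x) 0) (v := w)] at h3
    linarith
  · refine integral_mono (hp n).memLp.integrable_sq hw.memLp.integrable_sq fun x => ?_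
    refine pow_le_pow_left₀ (le_max_right _ _) (max_le ?_ (hw0 x)) 2
    have := mul_nonneg (Nat.cast_nonneg (α := ℝ) n) (hu0 x)
    linarith

lemma ae_ae_of_ae_crossSet {P : Rd d → Rd d → Prop}
    (h : ∀ᵐ p : Rd d × Rd d ∂(volume.restrict (crossSet D)), P p.1 p.2) :
    ∀ᵐ x ∂(volume.restrict D), ∀ᵐ y, P x y := by
  have h' := ae_restrict_of_ae_restrict_of_subset
    (show D ×ˢ Set.univ ⊆ crossSet D by rw [crossSet_eq]; exact Set.subset_union_left) h
  rw [Measure.volume_eq_prod, ← Measure.prod_restrict, Measure.restrict_univ] at h'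
  exact Measure.ae_ae_of_ae_prod h'

/-- The strong minimum principle: a nonnegative weak solution with nonnegative eigenvalue that
does not vanish identically on `D` is positive almost everywhere. -/
lemma ae_pos_of_eigenfunction (hν : IsSymmetricLevyDensity ν) (hβ : IsRobinCoefficient D β)
    (hD : Bornology.IsBounded D) (hu : MemForm ν β D u)
    (hu0 : ∀ x, 0 ≤ u x) (hm : 0 ≤ m)
    (heq : ∀ v, MemForm ν β D v → robinForm ν β D u v = m * ∫ x in D, u x * v x)
    (hne : ¬ ∀ᵐ x ∂(volume.restrict D), u x = 0) : ∀ᵐ x, 0 < u x := by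
  -- The cones about the origin of integer radii n are positive on balls exhausting ℝ^d, so this
  -- family of statements says that the zero set of u is null.
  have key : ∀ n : ℕ, ∀ᵐ y, {x | u x = 0}.indicator (cone 0 (n : ℝ)) y = 0 := by
    intro n
    set v := {x | u x = 0}.indicator (cone (0 : Rd d) (n : ℝ)) with hvdef
    have hv : MemForm ν β D v := memForm_mul_indicator_zero hν hβ hu hu0
      (memForm_cone hν hβ hD 0 n.cast_nonneg) (cone_nonneg 0 n) fun v hv hv0 => by
        rw [heq v hv]
        exact mul_nonneg hm (integral_nonneg fun x => mul_nonneg (hu0 x) (hv0 x))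
    have hv0 : ∀ x, 0 ≤ v x := Set.indicator_nonneg fun x _ => cone_nonneg 0 n x
    have huv : ∀ x, u x * v x = 0 := fun x => by
      by_cases hx : u x = 0
      · rw [hx, zero_mul]
      · rw [hvdef, Set.indicator_of_notMem (by simpa using hx), mul_zero]
    have h0 := heq v hv
    have hb : ∫ y in Dᶜ, β y * u y * v y = 0 := by simp [mul_assoc, huv]
    simp only [huv, integral_zero, mul_zero, robinForm, energyForm, hb, add_zero] at h0
    -- Since u v = 0 pointwise, the product of increments reduces to -(u(x)v(y) + u(y)v(x)), while
    -- the boundary term and the right-hand side of the equation vanish.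
    have h1 : ∫ p in crossSet D, (u p.1 * v p.2 + u p.2 * v p.1) * ν (p.1 - p.2) = 0 := by
      have h2 : ∫ p in crossSet D, (u p.1 - u p.2) * (v p.1 - v p.2) * ν (p.1 - p.2) = 0 := by
        simp only [crossSet]; linarith
      rw [← neg_eq_zero, ← integral_neg, ← h2]
      congr 1; ext p
      linear_combination (-(ν (p.1 - p.2))) * (huv p.1 + huv p.2)
    have hpt : ∀ p : Rd d × Rd d, 0 ≤ (u p.1 * v p.2 + u p.2 * v p.1) * ν (p.1 - p.2) := fun p =>
      mul_nonneg (add_nonneg (mul_nonneg (hu0 _) (hv0 _)) (mul_nonneg (hu0 _) (hv0 _)))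
        (hν.nonneg _)
    have hint : IntegrableOn (fun p : Rd d × Rd d =>
        (u p.1 * v p.2 + u p.2 * v p.1) * ν (p.1 - p.2)) (crossSet D) := by
      refine (hu.integrable_energy hν hβ hv).neg.congr (Eventually.of_forall fun p => ?_)
      simp only [Pi.neg_apply]
      linear_combination (-(ν (p.1 - p.2))) * (huv p.1 + huv p.2)
    have h3 := (integral_eq_zero_iff_of_nonneg hpt hint).1 h1
    have h4 : ∀ᵐ p : Rd d × Rd d ∂(volume.restrict (crossSet D)), u p.1 * v p.2 = 0 := by
      filter_upwards [h3, ae_restrict_of_ae (ae_kernel_pos hν.pos)] with p h5 h6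
      have h7 : u p.1 * v p.2 + u p.2 * v p.1 = 0 :=
        (mul_eq_zero.1 h5).resolve_right h6.ne'
      have := mul_nonneg (hu0 p.1) (hv0 p.2)
      have := mul_nonneg (hu0 p.2) (hv0 p.1)
      linarith
    have h5 := ae_ae_of_ae_crossSet (P := fun x y => u x * v y = 0) h4
    -- One point x of D with u(x) ≠ 0 suffices: it interacts with almost every y in ℝ^d, so v = 0
    -- almost everywhere.
    obtain ⟨x, hx1, hx2⟩ := ((not_eventually.1 hne).and_eventually h5).exists
    filter_upwards [hx2] with y hy
    exact (mul_eq_zero.1 hy).resolve_left hx1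
  filter_upwards [ae_all_iff.2 key] with y hy
  refine lt_of_le_of_ne (hu0 y) fun h => ?_
  obtain ⟨n, hn⟩ := exists_nat_gt ‖y‖
  have := hy n
  rw [Set.indicator_of_mem (by simpa using h.symm)] at this
  exact (cone_pos (by simpa using hn)).ne' this

/-- Zero energy and `ν` > 0 make u almost everywhere equal to a constant, nonzero because u does not
vanish on D. A vanishing boundary term would then force `β` = 0. -/
lemma robinForm_self_pos (hν : IsSymmetricLevyDensity ν) (hβ : IsRobinCoefficient D β)
    (hu : MemForm ν β D u) (hne : ¬ ∀ᵐ x ∂(volume.restrict D), u x = 0) :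
    0 < robinForm ν β D u u := by
  refine lt_of_le_of_ne (robinForm_self_nonneg hν hβ) fun h0 => hβ.nontrivial ?_
  obtain ⟨-, -, h3, h4⟩ := (memForm_iff hν hβ).1 hu
  rw [robinForm_self_eq] at h0
  have hE := integral_energyDensity_nonneg hν (u := u) (D := D)
  have hB := integral_boundary_nonneg hβ (u := u)
  have hE0 : ∫ p in crossSet D, energyDensity ν u p = 0 := by linarith
  have hB0 : ∫ y in Dᶜ, β y * u y ^ 2 = 0 := by linarith
  rw [integral_eq_zero_iff_of_nonneg (energyDensity_nonneg hν.nonneg) h3] at hE0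
  rw [integral_eq_zero_iff_of_nonneg_ae
    (by filter_upwards [hβ.nonneg] with y hy using mul_nonneg hy (sq_nonneg _)) h4] at hB0
  have h5 : ∀ᵐ p : Rd d × Rd d ∂(volume.restrict (crossSet D)), u p.1 = u p.2 := by
    filter_upwards [hE0, ae_restrict_of_ae (ae_kernel_pos hν.pos)] with p h5 h6
    exact sub_eq_zero.1 (pow_eq_zero_iff (two_ne_zero)|>.1
      ((mul_eq_zero.1 h5).resolve_right h6.ne'))
  have h6 := ae_ae_of_ae_crossSet (P := fun x y => u x = u y) h5
  obtain ⟨x, hx1, hx2⟩ := ((not_eventually.1 hne).and_eventually h6).exists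
  filter_upwards [hB0, ae_restrict_of_ae hx2] with y h7 h8
  refine (mul_eq_zero.1 h7).resolve_right ?_
  rw [← h8]
  exact pow_ne_zero 2 hx1

/-! ### The infimum of the Rayleigh quotient and its nonnegative minimizer. -/

/-- The set of values of the Robin form on the unit sphere of `L²(D)`. -/
def rayleighSet (ν β : Rd d → ℝ) (D : Set (Rd d)) : Set ℝ :=
  {q | ∃ u, MemForm ν β D u ∧ ∫ x in D, u x ^ 2 = 1 ∧ q = robinForm ν β D u u}

lemma bddBelow_rayleighSet (hν : IsSymmetricLevyDensity ν) (hβ : IsRobinCoefficient D β) :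
    BddBelow (rayleighSet ν β D) :=
  ⟨0, by rintro _ ⟨u, -, -, rfl⟩; exact robinForm_self_nonneg hν hβ⟩

lemma div_mem_rayleighSet (hν : IsSymmetricLevyDensity ν) (hβ : IsRobinCoefficient D β)
    (hu : MemForm ν β D u) (hpos : 0 < ∫ x in D, u x ^ 2) :
    robinForm ν β D u u / ∫ x in D, u x ^ 2 ∈ rayleighSet ν β D := by
  set s := ∫ x in D, u x ^ 2 with hs
  have hsq : (Real.sqrt s)⁻¹ ^ 2 = s⁻¹ := by rw [inv_pow, Real.sq_sqrt hpos.le]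
  refine ⟨fun x => (Real.sqrt s)⁻¹ * u x, hu.const_mul hν hβ _, ?_, ?_⟩
  · simp only [mul_pow, hsq]
    rw [integral_const_mul, ← hs, inv_mul_cancel₀ hpos.ne']
  · rw [robinForm_const_mul_left, robinForm_const_mul_right, ← mul_assoc, ← sq, hsq]
    ring

lemma sInf_rayleighSet_mul_le (hν : IsSymmetricLevyDensity ν) (hβ : IsRobinCoefficient D β)
    (hu : MemForm ν β D u) :
    sInf (rayleighSet ν β D) * ∫ x in D, u x ^ 2 ≤ robinForm ν β D u u := by
  have h0 : 0 ≤ ∫ x in D, u x ^ 2 := integral_nonneg fun _ => sq_nonneg _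
  rcases h0.eq_or_lt with h | h
  · rw [← h, mul_zero]; exact robinForm_self_nonneg hν hβ
  · exact (le_div_iff₀ h).1 (csInf_le (bddBelow_rayleighSet hν hβ)
      (div_mem_rayleighSet hν hβ hu h))

lemma integral_cone_sq_pos {z : Rd d} {r : ℝ} (hr : 0 < r) (hD : Metric.ball z r ⊆ D) :
    0 < ∫ x in D, cone z r x ^ 2 := by
  refine lt_of_lt_of_le ?_ (setIntegral_mono_set (integrable_cone_sq z r).integrableOn
    (Eventually.of_forall fun _ => sq_nonneg _) hD.eventuallyLE)
  rw [setIntegral_pos_iff_support_of_nonneg_ae (Eventually.of_forall fun _ => sq_nonneg _)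
    (integrable_cone_sq z r).integrableOn]
  refine (Metric.measure_ball_pos volume z hr).trans_le (measure_mono fun x hx => ⟨?_, hx⟩)
  exact (pow_pos (cone_pos hx) 2).ne'

lemma sInf_rayleighSet_lt (hν : IsSymmetricLevyDensity ν) (hβ : IsRobinCoefficient D β)
    (hDo : IsOpen D) (hD : Bornology.IsBounded D) (hne : D.Nonempty) :
    ENNReal.ofReal (sInf (rayleighSet ν β D)) < ∫⁻ h, ENNReal.ofReal (ν h) := by
  rcases eq_or_ne (∫⁻ h, ENNReal.ofReal (ν h)) ⊤ with htop | htop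
  · rw [htop]; exact ENNReal.ofReal_lt_top
  have hint : Integrable ν := (lintegral_ofReal_ne_top_iff_integrable
    hν.aemeasurable.aestronglyMeasurable (Eventually.of_forall hν.nonneg)).1 htop
  obtain ⟨z, hz⟩ := hne
  obtain ⟨r, hr, hball⟩ := Metric.isOpen_iff.1 hDo z hz
  have h1 := robinForm_cone_lt (β := β) hν hr hball hint
  have h2 := sInf_rayleighSet_mul_le hν hβ (memForm_cone hν hβ hD z hr.le)
  have h3 : sInf (rayleighSet ν β D) < ∫ h, ν h :=
    lt_of_mul_lt_mul_right (h2.trans_lt h1) (integral_cone_sq_pos hr hball).le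
  have h4 : 0 ≤ sInf (rayleighSet ν β D) := Real.sInf_nonneg (by
    rintro _ ⟨u, -, -, rfl⟩; exact robinForm_self_nonneg hν hβ)
  rw [← ofReal_integral_eq_lintegral_ofReal hint (Eventually.of_forall hν.nonneg)]
  exact (ENNReal.ofReal_lt_ofReal_iff (h4.trans_lt h3)).2 h3

/-- A coefficient that is not null needs a nonempty complement of D, so there are two distinct
points; this excludes dimension zero. -/
lemma nontrivial_of_isRobinCoefficient (hβ : IsRobinCoefficient D β) (hne : D.Nonempty) :
    Nontrivial (Rd d) := by
  obtain ⟨x, hx⟩ := hne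
  have hc : Dᶜ.Nonempty := by
    by_contra h
    rw [Set.not_nonempty_iff_eq_empty] at h
    exact hβ.nontrivial (by rw [h]; simp)
  obtain ⟨y, hy⟩ := hc
  exact ⟨x, y, fun h => hy (h ▸ hx)⟩

/-- Existence of a nonnegative normalized minimizer of the Rayleigh quotient. -/
lemma exists_nonneg_minimizer (hν : IsSymmetricLevyDensity ν) (hβ : IsRobinCoefficient D β)
    (hDo : IsOpen D) (hD : Bornology.IsBounded D) (hne : D.Nonempty) :
    ∃ u, MemForm ν β D u ∧ (∀ x, 0 ≤ u x) ∧ ∫ x in D, u x ^ 2 = 1 ∧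
      robinForm ν β D u u = sInf (rayleighSet ν β D) := by
  have := nontrivial_of_isRobinCoefficient hβ hne
  have hle := fun u (hu : MemForm ν β D u) => sInf_rayleighSet_mul_le hν hβ hu
  have hnon : (rayleighSet ν β D).Nonempty := by
    obtain ⟨z, hz⟩ := hne
    obtain ⟨r, hr, hball⟩ := Metric.isOpen_iff.1 hDo z hz
    exact ⟨_, div_mem_rayleighSet hν hβ (memForm_cone hν hβ hD z hr.le)
      (integral_cone_sq_pos hr hball)⟩
  obtain ⟨q, -, hq, hqmem⟩ := exists_seq_tendsto_sInf hnon (bddBelow_rayleighSet hν hβ)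
  choose us hus h1 h2 using hqmem
  obtain ⟨u, hu, hu1, huQ⟩ := exists_minimizer hν hβ hDo.measurableSet hD
    (hDo.measure_pos volume hne).ne' hle (sInf_rayleighSet_lt hν hβ hDo hD hne) hus h1
    (by simpa only [← h2] using hq)
  have habs : ∫ x in D, |u x| ^ 2 = 1 := by simpa only [sq_abs] using hu1
  refine ⟨fun x => |u x|, hu.abs hν hβ, fun x => abs_nonneg _, habs, ?_⟩
  refine le_antisymm ((robinForm_abs_le hν hβ hu).trans_eq huQ) ?_
  simpa only [habs, mul_one] using hle _ (hu.abs hν hβ)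

end

end NonlocalRobin

theorem proposition2p1 {d : ℕ} (D : Set (NonlocalRobin.Rd d)) (hDopen : IsOpen D)
    (hDbdd : Bornology.IsBounded D) (hDne : D.Nonempty)
    (ν β : NonlocalRobin.Rd d → ℝ) (hν : NonlocalRobin.IsSymmetricLevyDensity ν)
    (hβ : NonlocalRobin.IsRobinCoefficient D β) :
    ∃ μ₁ : ℝ, 0 < μ₁ ∧
      IsLeast (NonlocalRobin.robinEigenvalues ν β D) μ₁ ∧
      IsLeast {q : ℝ | ∃ u : NonlocalRobin.Rd d → ℝ, NonlocalRobin.MemForm ν β D u ∧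
        eLpNorm u 2 (volume.restrict D) = 1 ∧ q = NonlocalRobin.robinForm ν β D u u} μ₁ ∧
      ∃ ψ : NonlocalRobin.Rd d → ℝ, NonlocalRobin.IsRobinEigenpair ν β D μ₁ ψ ∧
        ∀ᵐ x ∂(volume : Measure (NonlocalRobin.Rd d)), 0 < ψ x := by
  have hle := fun u (hu : NonlocalRobin.MemForm ν β D u) =>
    NonlocalRobin.sInf_rayleighSet_mul_le hν hβ hu
  obtain ⟨ψ, hψ, hψ0, hψ1, hψQ⟩ :=
    NonlocalRobin.exists_nonneg_minimizer hν hβ hDopen hDbdd hDne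
  set μ₁ := sInf (NonlocalRobin.rayleighSet ν β D) with hμ
  have hψne : ¬ ∀ᵐ x ∂(volume.restrict D), ψ x = 0 := by
    rw [NonlocalRobin.ae_eq_zero_iff_integral_sq hψ.memLp, hψ1]
    exact one_ne_zero
  have hpos : 0 < μ₁ := hψQ ▸ NonlocalRobin.robinForm_self_pos hν hβ hψ hψne
  have hweak : ∀ v, NonlocalRobin.MemForm ν β D v →
      NonlocalRobin.robinForm ν β D ψ v = μ₁ * ∫ x in D, ψ x * v x := fun v hv =>
    NonlocalRobin.robinForm_eq_of_minimizer hν hβ hle hψ (by rw [hψ1, mul_one, hψQ]) hv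
  have heig : NonlocalRobin.IsRobinEigenpair ν β D μ₁ ψ := by
    refine ⟨⟨hψ, fun v hv => ?_⟩, hψne⟩
    simp only [hweak v hv, mul_assoc, integral_const_mul]
  refine ⟨μ₁, hpos, ⟨⟨ψ, heig⟩, ?_⟩, ⟨⟨ψ, hψ, ?_, hψQ.symm⟩, ?_⟩, ψ, heig, ?_⟩
  -- Testing the equation of any eigenfunction with itself makes its eigenvalue a Rayleigh quotient.
  · rintro μ ⟨u, ⟨hu, huw⟩, hune⟩
    have h1 := huw u hu
    simp only [mul_assoc, integral_const_mul, ← sq] at h1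
    have h2 := hle u hu
    rw [h1] at h2
    refine le_of_mul_le_mul_right h2 (lt_of_le_of_ne (integral_nonneg fun _ => sq_nonneg _) ?_)
    rw [NonlocalRobin.ae_eq_zero_iff_integral_sq hu.memLp] at hune
    exact Ne.symm hune
  · exact (NonlocalRobin.eLpNorm_eq_one_iff hψ.memLp).2 hψ1
  · rintro _ ⟨u, hu, hu1, rfl⟩
    simpa [(NonlocalRobin.eLpNorm_eq_one_iff hu.memLp).1 hu1] using hle u hu
  · exact NonlocalRobin.ae_pos_of_eigenfunction hν hβ hDbdd hψ hψ0 hpos.le hweak hψne
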